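/- **Conventions.** A *ranked alphabet* $\Sigma$ is a finite set of symbols with a rank map to $\mathbb N$ such that $\Sigma^{(0)}\neq\emptyset$, where $\Sigma^{(k)}$ is the set of symbols of rank $k$; $\mathrm{maxrk}(\Sigma)$ is its maximal rank and $T_\Sigma$ the set of trees over $\Sigma$. A *complete M-monoid* $(K,+,0,\Omega)$ is a commutative monoid with a sum operation $\sum_{i\in I}$ for all countable index sets $I$, which coincides with $+$ for finite $I$ and satisfies $\sum_{i\in I}a_i=\sum_{j\in J}\sum_{i\in I_j}a_i$ for every partition $I=\bigcup_{j\in J}I_j$ (blocks may be empty), together with a set $\Omega$ of finitary operations on $K$ that contains every constant zero operation $0_k$ ($k\in\mathbb N$) and all of whose members are absorptive (the value is $0$ as soon as one argument is $0$); $\Omega^{(k)}$ is the set of $k$-ary operations in $\Omega$. A *storage type* $S=(C,P,F,c_0)$ consists of a set $C$, a non-empty set $P$ of predicates $C\to\{0,1\}$, a non-empty set $F$ of partial functions $C\to C$, and $c_0\in C$. **Grammars.** An *$(S,\Sigma,K)$-rtg* $\mathcal G=(N,Z,R,\mathrm{wt})$ has a finite set $N$ of nonterminals, $Z\subseteq N$,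 a finite non-empty set $R$ of rules of the form $A(p)\to\sigma(A_1(f_1),\dots,A_k(f_k))$ with $\sigma\in\Sigma^{(k)}$, or $A(p)\to B(f)$ (chain rules), with nonterminals $A,A_i,B\in N$, $p\in P$ and $f,f_i\in F$, and a map $\mathrm{wt}$ that sends each rule with $k$ nonterminals on its right-hand side to an element of $\Omega^{(k)}$ (so $k=1$ for chain rules). A *derivation tree* for $\xi\in T_\Sigma$ is a tree $d$ over $R$ (a rule having as rank the number of nonterminals on its right-hand side) such that the left-hand side of the root rule is in $Z$, the nonterminals on the right-hand side of each rule are the left-hand sides of the rules at its children, $\xi$ results from $d$ by reading off the terminal symbols and disregarding chain rules, and there are configurations $c_w$ at the positions $w$ of $d$ with $c_\varepsilon=c_0$ such that, for the rule at $w$ with predicate $p$ and instructions $f_1,\dots,f_k$, one has $p(c_w)=1$ and $f_i(c_w)$ is defined and equals $c_{wi}$. The weight $\mathrm{wt}(d)\in K$ is obtained by evaluating the operations $\mathrm{wt}(r)$ along $d$, and $[\![\mathcal G]\!](\xi)=\sum_d\mathrm{wt}(d)$, summed over all derivation trees $d$ for $\xi$. Let $\mathrm{Reg}(S,\Sigma,K)$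 be the set of all $[\![\mathcal G]\!]:T_\Sigma\to K$. **Behaviours.** For finite non-empty $P'\subseteq P$, $F'\subseteq F$ let $\Delta$ be the ranked alphabet with $\Delta^{(k)}=P'\times(F')^k$ for $0\le k\le\max\{1,\mathrm{maxrk}(\Sigma)\}$. A *$\Delta$-behaviour* is a tree $b\in T_\Delta$ for which there are configurations $c_w$ at its positions with $c_\varepsilon=c_0$ such that, if $b$ has label $(p,f_1\dots f_k)$ at $w$, then $p(c_w)=1$ and $f_i(c_w)$ is defined and equals $c_{wi}$ for all $i$. With a new symbol $*$ of rank $1$, let $\langle\Delta,\Sigma\rangle$ be the ranked alphabet of all pairs $\langle\delta,\sigma\rangle$ with $\delta\in\Delta$ and $\sigma\in\Sigma\cup\{*\}$ of equal rank, which is the rank of the pair. For $\xi\in T_\Sigma$ let $\mathcal B_\Delta(\xi)$ be the set of all $\zeta\in T_{\langle\Delta,\Sigma\rangle}$ whose projection to $T_\Delta$ is a $\Delta$-behaviour and which are derivable from $\xi$ by the term rewriting rules $$\sigma(x_1,\dots,x_k)\to\langle\delta,*\rangle(\sigma(x_1,\dots,x_k))\ \ (\delta\in\Delta^{(1)}),\qquad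 \sigma(x_1,\dots,x_k)\to\langle\delta,\sigma\rangle(x_1,\dots,x_k)\ \ (\delta\in\Delta^{(k)}),$$ for all $k\ge 0$ and $\sigma\in\Sigma^{(k)}$. **Logic.** For a ranked alphabet $\Theta$, MSO-formulas over $\Theta$ are built from $\mathrm{label}_\sigma(x)$ ($\sigma\in\Theta$), $\mathrm{edge}_i(x,y)$ ($1\le i\le\mathrm{maxrk}(\Theta)$; $y$ is the $i$-th child of $x$) and $x\in X$ by $\neg,\vee,\wedge$ and first- and second-order $\exists,\forall$; they are interpreted in the positions of a tree as usual. *M-expressions* over $(\Theta,K)$ are given by $$E::=\mathrm H(\omega)\mid(E+E)\mid(\varphi\rhd E)\mid\textstyle\sum_xE\mid\sum_XE,$$ where $\varphi$ is an MSO-formula over $\Theta$ and $\omega$ is, for some finite set $\mathcal U$ of variables, a family of operations $\omega_{(\sigma,V)}\in\Omega^{(k)}$ ($\sigma\in\Theta^{(k)}$, $V\subseteq\mathcal U$); the free variables of $\mathrm H(\omega)$ are those in $\mathcal U$. On a tree $\xi\in T_\Theta$ with a variable assignment, $\mathrm H(\omega)$ is evaluated by applying at each position $w$ the operation $\omega_{(\sigma,V)}$,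 where $\sigma$ is the label of $w$ and $V$ is the set of those variables in $\mathcal U$ whose value is $w$ or contains $w$; $+$ is the addition of $K$; $\varphi\rhd e$ has the value of $e$ if $\varphi$ holds and $0$ otherwise; and $\sum_x$, $\sum_X$ sum over all positions, respectively all sets of positions, of $\xi$. A *sentence* is an M-expression $e$ without free variables; it defines $[\![e]\!]:T_\Theta\to K$. Let $\mathrm{Def}(S,\Sigma,K)$ be the set of all weighted tree languages $$[\![\textstyle\sum^{\mathrm{beh}}e]\!]:T_\Sigma\to K,\qquad \xi\mapsto\sum_{\zeta\in\mathcal B_\Delta(\xi)}[\![e]\!](\zeta),$$ where $P'\subseteq P$ and $F'\subseteq F$ are finite and non-empty, $\Delta$ is as above, and $e$ is an M-expression sentence over $(\langle\Delta,\Sigma\rangle,K)$. **Theorem.** For every storage type $S$, every ranked alphabet $\Sigma$ and every complete M-monoid $K$, $\mathrm{Reg}(S,\Sigma,K)=\mathrm{Def}(S,\Sigma,K)$. -/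

import Mathlib

universe u v w

namespace BET

/-! ### Ranked alphabets and trees -/

/-- A finite set of symbols with a rank function.  (That a symbol of rank `0` exists, which in
particular makes the alphabet non-empty, is a separate hypothesis.) -/
structure RankedAlphabet where
  Sym : Type u
  finite : Finite Sym
  rk : Sym → ℕ

attribute [instance] RankedAlphabet.finite

/-- The maximal rank of a symbol. -/
noncomputable def RankedAlphabet.maxrk (A : RankedAlphabet.{u}) : ℕ := ⨆ a, A.rk a

theorem RankedAlphabet.rk_le_maxrk (A : RankedAlphabet.{u}) (a : A.Sym) : A.rk a ≤ A.maxrk :=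
  le_ciSup (Set.finite_range A.rk).bddAbove a

/-- The set `T_A` of trees over `A`; `WType.mk a t` is the tree `a(t₁, …, t_k)`, `k = rk a`. -/
abbrev Tree (A : RankedAlphabet.{u}) : Type u := WType (fun a : A.Sym => Fin (A.rk a))

instance Tree.countable (A : RankedAlphabet.{u}) : Countable (Tree A) := by
  obtain ⟨n, ⟨e⟩⟩ := Finite.exists_equiv_fin A.Sym
  let _ : Encodable A.Sym := Encodable.ofEquiv _ e
  exact Encodable.countable

/-- The set of positions of a tree; as usual, the children of a node are numbered `1, …, k`. -/
def Tree.pos {A : RankedAlphabet.{u}} : Tree A → Finset (List ℕ)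
  | WType.mk _ t =>
    insert [] (Finset.univ.biUnion fun i => (Tree.pos (t i)).image fun w => (i.val + 1) :: w)

/-- The label of a tree at `w`; it is defined exactly if `w` is a position of the tree. -/
def Tree.label {A : RankedAlphabet.{u}} : Tree A → List ℕ → Option A.Sym
  | WType.mk a _, [] => some a
  | WType.mk a t, j :: w =>
    if h : 1 ≤ j ∧ j ≤ A.rk a then Tree.label (t ⟨j - 1, by omega⟩) w else none

/-- The label of the root. -/
def Tree.root {A : RankedAlphabet.{u}} : Tree A → A.Sym
  | WType.mk a _ => a

/-- The relabeling of trees that is induced by a rank preserving map of symbols. -/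
def Tree.relabel {A : RankedAlphabet.{u}} {B : RankedAlphabet.{v}} (g : A.Sym → B.Sym)
    (hg : ∀ a, B.rk (g a) = A.rk a) : Tree A → Tree B
  | WType.mk a t => WType.mk (g a) fun i => Tree.relabel g hg (t (Fin.cast (hg a) i))

/-- The unique homomorphism from the term algebra `T_A` to the `A`-algebra `(K, ω)`. -/
def Tree.hom {A : RankedAlphabet.{u}} {K : Type v} (ω : ∀ a : A.Sym, (Fin (A.rk a) → K) → K) :
    Tree A → K
  | WType.mk a t => ω a fun i => Tree.hom ω (t i)

/-! ### Complete multioperator monoids -/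

/-- A complete M-monoid `(K, +, 0, Ω)`: a commutative monoid with a sum operation for all
countable families, which extends finite sums and is compatible with all partitions of the index
set (`π` presents the partition into its fibres; blocks may be empty), and with a set `Ω` of
absorptive operations that contains all constant zero operations; `Ω k` is the set of `k`-ary
operations in `Ω`. -/
class CompleteMMonoid (K : Type w) extends AddCommMonoid K where
  sum : ∀ {I : Type} [Countable I], (I → K) → K
  sum_fintype : ∀ {I : Type} [Fintype I] (f : I → K), sum f = ∑ i, f i
  sum_partition : ∀ {I J : Type} [Countable I] [Countable J] (π : I → J) (f : I → K),
    sum f = sum fun j => sum fun i : {i // π i = j} => f i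
  Ω : ∀ k : ℕ, Set ((Fin k → K) → K)
  zero_mem : ∀ k, (fun _ => 0) ∈ Ω k
  absorptive : ∀ (k : ℕ), ∀ ω ∈ Ω k, ∀ (a : Fin k → K) (i : Fin k), a i = 0 → ω a = 0

/-- The sum of a countable family whose index set lives in an arbitrary universe: transport the
index set to the lowest universe along a bijection. -/
noncomputable def csum {K : Type w} [CompleteMMonoid K] {I : Type v} [Countable I]
    (f : I → K) : K :=
  have : Countable (Shrink.{0} I) := (equivShrink.{0} I).symm.injective.countable
  CompleteMMonoid.sum fun j : Shrink.{0} I => f ((equivShrink.{0} I).symm j)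

/-- The composition `τ ; s` of a tree transformation and a weighted tree language. -/
noncomputable def comp {A : RankedAlphabet.{u}} {B : RankedAlphabet.{v}} {K : Type w}
    [CompleteMMonoid K] (τ : Tree A → Set (Tree B)) (s : Tree B → K) : Tree A → K :=
  fun ξ => csum fun ζ : τ ξ => s ζ

/-! ### Storage types and behaviours -/

/-- A storage type `(C, P, F, c₀)`. -/
structure StorageType where
  Conf : Type u
  P : Set (Conf → Bool)
  F : Set (Conf →. Conf)
  init : Conf
  P_nonempty : P.Nonempty
  F_nonempty : F.Nonempty

/-- The ranked alphabet `Δ` that is `n`-corresponding to finite subsets `P'` and `F'` of the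
predicates and instructions: the symbols of rank `k ≤ n` are the elements of `P' × (F')ᵏ`. -/
def corrAlphabet {S : StorageType.{u}} (n : ℕ) (P' : Finset S.P) (F' : Finset S.F) :
    RankedAlphabet.{u} where
  Sym := Σ k : Fin (n + 1), P' × (Fin k → F')
  finite := inferInstance
  rk := fun δ => δ.1

/-- The ranked alphabet corresponding to `Sig`, `P'` and `F'`.  The maximum with `1` matters only
if all symbols of `Sig` have rank `0`; it provides the symbols `(p, f)` for chain rules in that
case too. -/
noncomputable def corr {S : StorageType.{u}} (Sig : RankedAlphabet.{v}) (P' : Finset S.P)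
    (F' : Finset S.F) : RankedAlphabet.{u} :=
  corrAlphabet (max 1 Sig.maxrk) P' F'

/-- The set `𝓑(Δ, c)` of `(Δ, c)`-behaviours, by families `(c_w)` of configurations. -/
def behaviours {S : StorageType.{u}} {n : ℕ} {P' : Finset S.P} {F' : Finset S.F} (c : S.Conf) :
    Set (Tree (corrAlphabet n P' F')) :=
  {b | ∃ conf : List ℕ → S.Conf, conf [] = c ∧
    ∀ w ∈ b.pos, ∀ δ : (corrAlphabet n P' F').Sym, b.label w = some δ →
      δ.2.1.1.1 (conf w) = true ∧
      ∀ i : Fin δ.1, conf (w ++ [i.val + 1]) ∈ (δ.2.2 i).1.1 (conf w)}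

/-! ### Weighted regular tree grammars with storage -/

/-- Rules `A(p) → σ(A₁(f₁), …, A_k(f_k))` and chain rules `A(p) → B(f)`. -/
inductive Rule (S : StorageType.{u}) (Sig : RankedAlphabet.{v}) (N : Type) : Type (max u v)
  | sym (A : N) (p : S.P) (σ : Sig.Sym) (B : Fin (Sig.rk σ) → N) (f : Fin (Sig.rk σ) → S.F)
  | chain (A : N) (p : S.P) (B : N) (f : S.F)

namespace Rule

variable {S : StorageType.{u}} {Sig : RankedAlphabet.{v}} {N : Type}

/-- The number of nonterminals in the right-hand side. -/
def rank : Rule S Sig N → ℕ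
  | sym _ _ σ _ _ => Sig.rk σ
  | chain _ _ _ _ => 1

def lhs : Rule S Sig N → N
  | sym A _ _ _ _ => A
  | chain A _ _ _ => A

def pred : Rule S Sig N → S.P
  | sym _ p _ _ _ => p
  | chain _ p _ _ => p

def rhs : (r : Rule S Sig N) → Fin r.rank → N
  | sym _ _ _ B _ => B
  | chain _ _ B _ => fun _ => B

def instr : (r : Rule S Sig N) → Fin r.rank → S.F
  | sym _ _ _ _ f => f
  | chain _ _ _ f => fun _ => f

theorem rank_le (r : Rule S Sig N) : r.rank ≤ max 1 Sig.maxrk := by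
  cases r with
  | sym A p σ B f => exact (Sig.rk_le_maxrk σ).trans (le_max_right _ _)
  | chain A p B f => exact le_max_left _ _

end Rule

/-- An `(S, Sig, K)`-regular tree grammar `(N, Z, R, wt)`.  As `N` is finite, it is no restriction
that it lives in the lowest universe. -/
structure RTG (S : StorageType.{u}) (Sig : RankedAlphabet.{v}) (K : Type w) [CompleteMMonoid K]
    where
  N : Type
  finite_N : Finite N
  Z : Set N
  R : Set (Rule S Sig N)
  finite_R : R.Finite
  nonempty_R : R.Nonempty
  wt : ∀ r : R, CompleteMMonoid.Ω (K := K) r.1.rank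

namespace RTG

variable {S : StorageType.{u}} {Sig : RankedAlphabet.{v}} {K : Type w} [CompleteMMonoid K]

/-- The rules, as a ranked alphabet. -/
def rules (G : RTG S Sig K) : RankedAlphabet.{max u v} where
  Sym := G.R
  finite := G.finite_R
  rk := fun r => r.1.rank

open Classical in
/-- The finite set `P_G` of predicates that occur in the rules. -/
noncomputable def preds (G : RTG S Sig K) : Finset S.P :=
  G.finite_R.toFinset.image Rule.pred

open Classical in
/-- The finite set `F_G` of instructions that occur in the rules. -/
noncomputable def instrs (G : RTG S Sig K) : Finset S.F :=
  G.finite_R.toFinset.biUnion fun r => Finset.univ.image r.instr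

/-- The map `β` from rules to `Δ_G`, the ranked alphabet corresponding to `Sig`, `P_G`, `F_G`. -/
noncomputable def beta (G : RTG S Sig K) (r : G.rules.Sym) :
    (corr Sig G.preds G.instrs).Sym :=
  ⟨⟨r.1.rank, Nat.lt_succ_of_le r.1.rank_le⟩,
    ⟨r.1.pred, by
      classical
      exact Finset.mem_image_of_mem _ (G.finite_R.mem_toFinset.2 r.2)⟩,
    fun i => ⟨r.1.instr i, by
      classical
      exact Finset.mem_biUnion.2 ⟨r.1, G.finite_R.mem_toFinset.2 r.2,
        Finset.mem_image_of_mem _ (Finset.mem_univ i)⟩⟩⟩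

/-- The tree `β(d)` over `Δ_G`. -/
noncomputable def betaTree (G : RTG S Sig K) : Tree G.rules → Tree (corr Sig G.preds G.instrs) :=
  Tree.relabel G.beta fun _ => rfl

/-- The map `π` that reads off the terminal tree. -/
def proj (G : RTG S Sig K) : Tree G.rules → Tree Sig
  | WType.mk ⟨Rule.sym _ _ σ _ _, _⟩ d => WType.mk σ fun i => proj G (d i)
  | WType.mk ⟨Rule.chain _ _ _ _, _⟩ d => proj G (d (0 : Fin 1))

/-- The set of `(N', c)`-derivation trees of `G` for `ξ`. -/
def derivations (G : RTG S Sig K) (N' : Set G.N) (ξ : Tree Sig) (c : S.Conf) :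
    Set (Tree G.rules) :=
  {d | d.root.1.lhs ∈ N' ∧ G.proj d = ξ ∧
    (∀ w ∈ d.pos, ∀ r : G.rules.Sym, d.label w = some r → ∀ i : Fin r.1.rank,
      ∃ r' : G.rules.Sym, d.label (w ++ [i.val + 1]) = some r' ∧ r.1.rhs i = r'.1.lhs) ∧
    G.betaTree d ∈ behaviours c}

/-- The weight of a derivation tree. -/
def weight (G : RTG S Sig K) : Tree G.rules → K :=
  Tree.hom fun r => (G.wt r).1

/-- The weighted tree language `⟦G⟧` generated by `G`. -/
noncomputable def language (G : RTG S Sig K) : Tree Sig → K :=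
  fun ξ => csum fun d : G.derivations G.Z ξ S.init => G.weight d

end RTG

/-- The class `Reg(S, Sig, K)`. -/
def Reg (S : StorageType.{u}) (Sig : RankedAlphabet.{v}) (K : Type w) [CompleteMMonoid K] :
    Set (Tree Sig → K) :=
  {s | ∃ G : RTG S Sig K, s = G.language}

/-! ### Behaviours on trees -/

/-- The rank of an element of `Sig ∪ {*}`, where `none` stands for the unary symbol `*`. -/
def starRk (Sig : RankedAlphabet.{v}) : Option Sig.Sym → ℕ
  | none => 1
  | some σ => Sig.rk σ

/-- The `Sig`-extension `⟨Δ, Sig⟩` of `Δ`: the symbols are the pairs `⟨δ, σ⟩` in `Δ × (Sig ∪ {*})`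
of equal rank. -/
def extension (Δ : RankedAlphabet.{u}) (Sig : RankedAlphabet.{v}) : RankedAlphabet.{max u v} where
  Sym := {q : Δ.Sym × Option Sig.Sym // Δ.rk q.1 = starRk Sig q.2}
  finite := inferInstance
  rk := fun q => Δ.rk q.1.1

/-- The ranked alphabet `Sig ∪ ⟨Δ, Sig⟩` (disjoint union) in which the rewriting takes place. -/
def mixed (Δ : RankedAlphabet.{u}) (Sig : RankedAlphabet.{v}) : RankedAlphabet.{max u v} where
  Sym := Sig.Sym ⊕ (extension Δ Sig).Sym
  finite := inferInstance
  rk := Sum.elim Sig.rk (extension Δ Sig).rk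

/-- The rewrite relation of the term rewriting system with the rules
`σ(x₁, …, x_k) → ⟨δ, *⟩(σ(x₁, …, x_k))` for `δ` of rank `1` and
`σ(x₁, …, x_k) → ⟨δ, σ⟩(x₁, …, x_k)` for `δ` of rank `k`. -/
inductive Rewrite (Δ : RankedAlphabet.{u}) (Sig : RankedAlphabet.{v}) :
    Tree (mixed Δ Sig) → Tree (mixed Δ Sig) → Prop
  | star (σ : Sig.Sym) (t : Fin (Sig.rk σ) → Tree (mixed Δ Sig)) (δ : Δ.Sym) (h : Δ.rk δ = 1) :
      Rewrite Δ Sig (WType.mk (Sum.inl σ) t)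
        (WType.mk (Sum.inr ⟨(δ, none), h⟩) fun _ => WType.mk (Sum.inl σ) t)
  | sym (σ : Sig.Sym) (t : Fin (Sig.rk σ) → Tree (mixed Δ Sig)) (δ : Δ.Sym)
      (h : Δ.rk δ = Sig.rk σ) :
      Rewrite Δ Sig (WType.mk (Sum.inl σ) t)
        (WType.mk (Sum.inr ⟨(δ, some σ), h⟩) fun i : Fin (Δ.rk δ) => t (Fin.cast h i))
  | context (a : (mixed Δ Sig).Sym) (t : Fin ((mixed Δ Sig).rk a) → Tree (mixed Δ Sig))
      (i : Fin ((mixed Δ Sig).rk a)) (t' : Tree (mixed Δ Sig)) (h : Rewrite Δ Sig (t i) t') :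
      Rewrite Δ Sig (WType.mk a t) (WType.mk a (Function.update t i t'))

/-- The map `𝓑_Δ`: the set of `Δ`-behaviours on a tree `ξ`. -/
def behavioursOn {S : StorageType.{u}} (Sig : RankedAlphabet.{v}) (P' : Finset S.P)
    (F' : Finset S.F) (ξ : Tree Sig) : Set (Tree (extension (corr Sig P' F') Sig)) :=
  {ζ | Relation.ReflTransGen (Rewrite (corr Sig P' F') Sig)
        (Tree.relabel (B := mixed (corr Sig P' F') Sig) Sum.inl (fun _ => rfl) ξ)
        (Tree.relabel (B := mixed (corr Sig P' F') Sig) Sum.inr (fun _ => rfl) ζ) ∧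
      Tree.relabel (B := corr Sig P' F') (fun q : (extension (corr Sig P' F') Sig).Sym => q.1.1)
        (fun _ => rfl) ζ ∈ behaviours S.init}

/-! ### MSO-logic and M-expressions over a ranked alphabet -/

/-- Variables: `Sum.inl x` is a first-order and `Sum.inr X` is a second-order variable. -/
abbrev Var : Type := ℕ ⊕ ℕ

/-- The formulas of MSO-logic over `Θ`; `edge i` stands for the edge to the child with number
`i + 1`, which is an element of `{1, …, maxrk Θ}`. -/
inductive MSO (Θ : RankedAlphabet.{u}) : Type u
  | label (σ : Θ.Sym) (x : ℕ)
  | edge (i : Fin Θ.maxrk) (x y : ℕ)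
  | mem (x X : ℕ)
  | not (φ : MSO Θ)
  | or (φ ψ : MSO Θ)
  | and (φ ψ : MSO Θ)
  | ex₁ (x : ℕ) (φ : MSO Θ)
  | all₁ (x : ℕ) (φ : MSO Θ)
  | ex₂ (X : ℕ) (φ : MSO Θ)
  | all₂ (X : ℕ) (φ : MSO Θ)

/-- The free variables of a formula. -/
def MSO.free {Θ : RankedAlphabet.{u}} : MSO Θ → Finset Var
  | label _ x => {Sum.inl x}
  | edge _ x y => {Sum.inl x, Sum.inl y}
  | mem x X => {Sum.inl x, Sum.inr X}
  | not φ => φ.free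
  | or φ ψ => φ.free ∪ ψ.free
  | and φ ψ => φ.free ∪ ψ.free
  | ex₁ x φ => φ.free.erase (Sum.inl x)
  | all₁ x φ => φ.free.erase (Sum.inl x)
  | ex₂ X φ => φ.free.erase (Sum.inr X)
  | all₂ X φ => φ.free.erase (Sum.inr X)

/-- Variable assignments: positions for first-order, sets of positions for second-order
variables. -/
structure Assignment where
  fo : ℕ → List ℕ
  so : ℕ → Finset (List ℕ)

namespace Assignment

def setFO (ρ : Assignment) (x : ℕ) (p : List ℕ) : Assignment :=
  ⟨Function.update ρ.fo x p, ρ.so⟩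

def setSO (ρ : Assignment) (X : ℕ) (I : Finset (List ℕ)) : Assignment :=
  ⟨ρ.fo, Function.update ρ.so X I⟩

/-- The variable is assigned to the position `p`, or to a set that contains `p`. -/
def Marks (ρ : Assignment) (p : List ℕ) : Var → Prop
  | Sum.inl x => ρ.fo x = p
  | Sum.inr X => p ∈ ρ.so X

/-- An assignment for every tree (the root, the empty set), to start the evaluation of sentences,
whose value does not depend on the assignment. -/
def start : Assignment := ⟨fun _ => [], fun _ => ∅⟩

end Assignment

/-- `ξ` together with the assignment `ρ` is a model of the formula. -/
def MSO.Sat {Θ : RankedAlphabet.{u}} (ξ : Tree Θ) : Assignment → MSO Θ → Prop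
  | ρ, label σ x => ξ.label (ρ.fo x) = some σ
  | ρ, edge i x y => ρ.fo y = ρ.fo x ++ [i.val + 1]
  | ρ, mem x X => ρ.fo x ∈ ρ.so X
  | ρ, not φ => ¬ MSO.Sat ξ ρ φ
  | ρ, or φ ψ => MSO.Sat ξ ρ φ ∨ MSO.Sat ξ ρ ψ
  | ρ, and φ ψ => MSO.Sat ξ ρ φ ∧ MSO.Sat ξ ρ ψ
  | ρ, ex₁ x φ => ∃ p ∈ ξ.pos, MSO.Sat ξ (ρ.setFO x p) φ
  | ρ, all₁ x φ => ∀ p ∈ ξ.pos, MSO.Sat ξ (ρ.setFO x p) φ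
  | ρ, ex₂ X φ => ∃ I ⊆ ξ.pos, MSO.Sat ξ (ρ.setSO X I) φ
  | ρ, all₂ X φ => ∀ I ⊆ ξ.pos, MSO.Sat ξ (ρ.setSO X I) φ

/-- The ranked alphabet `Θ_U` with `Θ_U⁽ᵏ⁾ = Θ⁽ᵏ⁾ × 𝓟(U)`. -/
def withVars (Θ : RankedAlphabet.{u}) (U : Finset Var) : RankedAlphabet.{u} where
  Sym := Θ.Sym × Set U
  finite := inferInstance
  rk := fun a => Θ.rk a.1

/-- The tree over `Θ_U` that corresponds to a tree over `Θ`, placed at the position `p`, and an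
assignment: each label is paired with the set of those variables in `U` which mark its position. -/
def encode {Θ : RankedAlphabet.{u}} (U : Finset Var) (ρ : Assignment) :
    List ℕ → Tree Θ → Tree (withVars Θ U)
  | p, WType.mk a t =>
    WType.mk (β := fun a : (withVars Θ U).Sym => Fin ((withVars Θ U).rk a))
      (a, {x : U | ρ.Marks p x.1}) fun i : Fin (Θ.rk a) => encode U ρ (p ++ [i.val + 1]) (t i)

/-- The M-expressions over `(Θ, K)`: `H(ω)` for a `Θ_U`-family `ω` of operations in `Ω` and a
finite set `U` of variables, `e₁ + e₂`, `φ ▷ e`, `∑ₓ e` and `∑_X e`. -/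
inductive MExp (Θ : RankedAlphabet.{u}) (K : Type w) [CompleteMMonoid K] : Type (max u w)
  | H (U : Finset Var)
      (ω : ∀ a : (withVars Θ U).Sym, CompleteMMonoid.Ω (K := K) ((withVars Θ U).rk a))
  | add (e₁ e₂ : MExp Θ K)
  | guard (φ : MSO Θ) (e : MExp Θ K)
  | sum₁ (x : ℕ) (e : MExp Θ K)
  | sum₂ (X : ℕ) (e : MExp Θ K)

namespace MExp

variable {Θ : RankedAlphabet.{u}} {K : Type w} [CompleteMMonoid K]

/-- The free variables of an M-expression. -/
def free : MExp Θ K → Finset Var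
  | H U _ => U
  | add e₁ e₂ => e₁.free ∪ e₂.free
  | guard φ e => φ.free ∪ e.free
  | sum₁ x e => e.free.erase (Sum.inl x)
  | sum₂ X e => e.free.erase (Sum.inr X)

open Classical in
/-- The value of an M-expression on a tree and an assignment. -/
noncomputable def eval (ξ : Tree Θ) : Assignment → MExp Θ K → K
  | ρ, H U ω => Tree.hom (fun a => (ω a).1) (encode U ρ [] ξ)
  | ρ, add e₁ e₂ => eval ξ ρ e₁ + eval ξ ρ e₂
  | ρ, guard φ e => if MSO.Sat ξ ρ φ then eval ξ ρ e else 0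
  | ρ, sum₁ x e => ∑ p ∈ ξ.pos, eval ξ (ρ.setFO x p) e
  | ρ, sum₂ X e => ∑ I ∈ ξ.pos.powerset, eval ξ (ρ.setSO X I) e

/-- A sentence is an M-expression without free variables. -/
def IsSentence (e : MExp Θ K) : Prop := e.free = ∅

/-- The weighted tree language `⟦e⟧` of a sentence `e`. -/
noncomputable def language (e : MExp Θ K) : Tree Θ → K := fun ξ => eval ξ Assignment.start e

end MExp

/-! ### Definability by expressions with behaviours -/

/-- The semantics `𝓑_Δ ; ⟦e⟧` of the expression `∑ᵇᵉʰ e`. -/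
noncomputable def sumBeh {S : StorageType.{u}} {Sig : RankedAlphabet.{v}} {K : Type w}
    [CompleteMMonoid K] (P' : Finset S.P) (F' : Finset S.F)
    (e : MExp (extension (corr Sig P' F') Sig) K) : Tree Sig → K :=
  comp (behavioursOn Sig P' F') e.language

/-- The class `Def(S, Sig, K)`. -/
def Def (S : StorageType.{u}) (Sig : RankedAlphabet.{v}) (K : Type w) [CompleteMMonoid K] :
    Set (Tree Sig → K) :=
  {s | ∃ (P' : Finset S.P) (F' : Finset S.F), P'.Nonempty ∧ F'.Nonempty ∧
    ∃ e : MExp (extension (corr Sig P' F') Sig) K, e.IsSentence ∧ sumBeh P' F' e = s}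

end BET

/-!
A grammar and an expression `∑ᵇᵉʰ e` both factor through the set `𝓑_Δ(ξ)` of behaviours on a
terminal tree `ξ`, and the storage type matters only there.

For a grammar `G` whose predicates and instructions belong to `P'` and `F'`, forgetting the
nonterminals turns a derivation tree for `ξ` into an element of `𝓑_Δ(ξ)`; conversely, a tree of
rules is a derivation tree for `ξ` exactly if its nonterminals fit together and its image belongs
to `𝓑_Δ(ξ)`.  The only nontrivial point is that a tree over `⟨Δ, Sig⟩` is derivable from `ξ` by
rewriting if and only if removing `Δ` and `*` from it yields `ξ` (`reflTransGen_rewrite_iff`).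
Partitioning the sum over all derivation trees accordingly gives `⟦G⟧ = 𝓑_Δ ; s_G`
(`RTG.language_eq_comp`), where `s_G(ζ)` is the finite sum of the weights of the consistent
labelings of `ζ` by rules (`RTG.behWeight`).  It remains to compare the functions `s_G` with the
functions `⟦e⟧` for sentences `e` over `⟨Δ, Sig⟩`: a theorem of Büchi type for weighted tree
automata over M-monoids.

*From expressions to grammars.*  The operations in `Ω` need not distribute over sums, hence the
value of an expression is kept as one global sum: it is a sum over all markings of the positions
by elements of a finite set, restricted by a finite algebra, of the value of the tree under
operations that are chosen by label and mark (`RunDefinable`, `MExp.exists_language_eq_sum`).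
This form is stable under all constructs of the logic.  For `φ ▷ e` one needs that MSO-definable
properties are recognized by finite algebras (`MSO.isRecognizable`), where quantifiers are treated
by the subset construction `markedHom_powerset`.  A grammar whose nonterminals are pairs of a state
of the algebra and a mark computes such a sum (`behWeight_runGrammar`).

*From grammars to expressions.*  Guess, for every rule, the set of positions at which it is
applied.  By absorption, the choice of the operations in `H(ω)` makes all guesses vanish
that do not describe a labeling by fitting rules (`RTG.exists_marksRules`), and an MSO-formula
checks the nonterminals (`RTG.sat_derivationFormula`); this yields `RTG.language_toMExp`.
-/

namespace BET

/-! ### Sums over countable families -/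

section CountableSums

variable {K : Type w} [CompleteMMonoid K]

theorem CompleteMMonoid.sum_equiv {I J : Type} [Countable I] [Countable J] (e : I ≃ J)
    (f : J → K) : CompleteMMonoid.sum (fun i => f (e i)) = CompleteMMonoid.sum f := by
  rw [CompleteMMonoid.sum_partition e]
  congr 1
  funext j
  let _ : Unique {i // e i = j} :=
    ⟨⟨⟨e.symm j, by simp⟩⟩, fun ⟨i, hi⟩ => by subst hi; simp⟩
  rw [CompleteMMonoid.sum_fintype, Fintype.sum_unique]
  exact congrArg f (default : {i // e i = j}).2

/-- The transport of the index set to the lowest universe may use any bijection. -/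
theorem csum_eq_sum {I : Type v} [Countable I] {J : Type} [Countable J] (e : J ≃ I) (f : I → K) :
    csum f = CompleteMMonoid.sum fun j => f (e j) := by
  have : Countable (Shrink.{0} I) := (equivShrink.{0} I).symm.injective.countable
  rw [csum, ← CompleteMMonoid.sum_equiv (e.trans (equivShrink.{0} I))]
  simp

theorem csum_equiv {I : Type u} {J : Type v} [Countable I] [Countable J] (e : I ≃ J) (f : J → K) :
    csum (fun i => f (e i)) = csum f := by
  have : Countable (Shrink.{0} I) := (equivShrink.{0} I).symm.injective.countable
  rw [csum_eq_sum (equivShrink.{0} I).symm, csum_eq_sum ((equivShrink.{0} I).symm.trans e)]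
  rfl

theorem csum_fintype {I : Type v} [Fintype I] [Countable I] (f : I → K) :
    csum f = ∑ i, f i := by
  rw [csum_eq_sum (Fintype.equivFin I).symm, CompleteMMonoid.sum_fintype]
  exact Equiv.sum_comp (Fintype.equivFin I).symm f

theorem csum_partition {I : Type u} {J : Type v} [Countable I] [Countable J] (π : I → J)
    (f : I → K) : csum f = csum fun j => csum fun i : {i // π i = j} => f i := by
  have : Countable (Shrink.{0} I) := (equivShrink.{0} I).symm.injective.countable
  have : Countable (Shrink.{0} J) := (equivShrink.{0} J).symm.injective.countable
  let eI := (equivShrink.{0} I).symm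
  let eJ := (equivShrink.{0} J).symm
  rw [csum_eq_sum eI, csum_eq_sum eJ, CompleteMMonoid.sum_partition fun i => eJ.symm (π (eI i))]
  congr 1
  funext j
  let e : {i // eJ.symm (π (eI i)) = j} ≃ {i // π i = eJ j} :=
    eI.subtypeEquiv fun i => by rw [Equiv.symm_apply_eq]
  rw [csum_eq_sum e]
  rfl

/-- A finite sum may be computed over any injective family of indices that meets all nonzero
terms. -/
theorem csum_eq_sum_of_injective {I : Type u} {J : Type v} [Countable I] [Fintype J] (e : I → J)
    (he : Function.Injective e) (f : I → K) (g : J → K) (h₀ : ∀ j, g j ≠ 0 → ∃ i, e i = j)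
    (h : ∀ i, f i = g (e i)) : csum f = ∑ j, g j := by
  classical
  have := Fintype.ofInjective e he
  rw [csum_fintype]
  exact Fintype.sum_of_injective e he f g
    (fun j hj => by_contra fun hg => hj (h₀ j hg)) h

end CountableSums

/-! ### Positions and labels of trees -/

namespace Tree

variable {A : RankedAlphabet.{u}} {B : RankedAlphabet.{v}}

theorem nil_mem_pos (t : Tree A) : [] ∈ t.pos := by
  cases t; simp [pos]

theorem mem_pos_mk {a : A.Sym} {t : Fin (A.rk a) → Tree A} {w : List ℕ} :
    w ∈ pos (WType.mk a t) ↔ w = [] ∨ ∃ i, ∃ w' ∈ pos (t i), (i.val + 1) :: w' = w := by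
  simp [pos]

theorem cons_mem_pos {a : A.Sym} {t : Fin (A.rk a) → Tree A} {i : Fin (A.rk a)} {w : List ℕ} :
    (i.val + 1) :: w ∈ pos (WType.mk a t) ↔ w ∈ pos (t i) := by
  rw [mem_pos_mk]
  constructor
  · rintro (h | ⟨j, w', hw', h⟩)
    · cases h
    · simp only [List.cons.injEq, Nat.add_right_cancel_iff, Fin.val_inj] at h
      obtain ⟨rfl, rfl⟩ := h
      exact hw'
  · exact fun h => Or.inr ⟨i, w, h, rfl⟩

theorem forall_mem_pos_mk {a : A.Sym} {t : Fin (A.rk a) → Tree A} {p : List ℕ → Prop} :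
    (∀ w ∈ pos (WType.mk a t), p w) ↔ p [] ∧ ∀ i, ∀ w ∈ pos (t i), p ((i.val + 1) :: w) := by
  constructor
  · exact fun h => ⟨h _ (nil_mem_pos _), fun i w hw => h _ (cons_mem_pos.2 hw)⟩
  · rintro ⟨h₀, h⟩ w hw
    obtain rfl | ⟨i, w', hw', rfl⟩ := mem_pos_mk.1 hw
    exacts [h₀, h i w' hw']

theorem exists_mem_pos_mk {a : A.Sym} {t : Fin (A.rk a) → Tree A} {p : List ℕ → Prop} :
    (∃ w ∈ pos (WType.mk a t), p w) ↔ p [] ∨ ∃ i, ∃ w ∈ pos (t i), p ((i.val + 1) :: w) := by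
  have := not_congr (forall_mem_pos_mk (t := t) (p := fun w => ¬ p w))
  push Not at this
  rw [this, or_iff_not_imp_left]

theorem sum_pos_mk {M : Type w} [AddCommMonoid M] {a : A.Sym} {t : Fin (A.rk a) → Tree A}
    (f : List ℕ → M) :
    ∑ w ∈ pos (WType.mk a t), f w = f [] + ∑ i, ∑ w ∈ pos (t i), f ((i.val + 1) :: w) := by
  rw [pos, Finset.sum_insert (by simp), Finset.sum_biUnion]
  · congr 1
    refine Finset.sum_congr rfl fun i _ => ?_
    rw [Finset.sum_image (by simp)]
  · intro i _ j _ hij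
    rw [Function.onFun, Finset.disjoint_left]
    intro w hi hj
    simp only [Finset.mem_image] at hi hj
    obtain ⟨w₁, -, rfl⟩ := hi
    obtain ⟨w₂, -, h⟩ := hj
    simp only [List.cons.injEq, Nat.add_right_cancel_iff, Fin.val_inj] at h
    exact hij h.1.symm

@[simp] theorem label_nil {a : A.Sym} {t : Fin (A.rk a) → Tree A} :
    label (WType.mk a t) [] = some a := by
  simp [label]

@[simp] theorem label_cons {a : A.Sym} {t : Fin (A.rk a) → Tree A} {i : Fin (A.rk a)}
    {w : List ℕ} : label (WType.mk a t) ((i.val + 1) :: w) = label (t i) w := by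
  rw [label, dif_pos ⟨by omega, by omega⟩]
  congr

theorem label_root (t : Tree A) : t.label [] = some t.root := by
  cases t; simp [root]

theorem mem_pos_iff {t : Tree A} {w : List ℕ} : w ∈ t.pos ↔ ∃ a, t.label w = some a := by
  induction t generalizing w with
  | mk a t ih =>
    rcases w with _ | ⟨j, w⟩
    · simp [nil_mem_pos]
    · by_cases h : 1 ≤ j ∧ j ≤ A.rk a
      · obtain ⟨i, rfl⟩ : ∃ i : Fin (A.rk a), i.val + 1 = j := ⟨⟨j - 1, by omega⟩, by simp; omega⟩
        rw [cons_mem_pos, label_cons, ih]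
      · rw [label, dif_neg h, mem_pos_mk]
        simp only [reduceCtorEq, List.cons.injEq, false_or, exists_false, iff_false]
        rintro ⟨i, w', -, rfl, -⟩
        exact h ⟨by omega, by omega⟩

theorem mk_inj {a a' : A.Sym} {t : Fin (A.rk a) → Tree A} {t' : Fin (A.rk a') → Tree A}
    (h : (WType.mk a t : Tree A) = WType.mk a' t') :
    ∃ e : a = a', ∀ i, t i = t' (Fin.cast (congrArg A.rk e) i) := by
  cases h
  exact ⟨rfl, fun _ => rfl⟩

/-- A tree is determined by its labels. -/
theorem ext_label {t t' : Tree A} (h : ∀ w, t.label w = t'.label w) : t = t' := by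
  induction t generalizing t' with
  | mk a t ih =>
    obtain ⟨a', t'⟩ := t'
    obtain rfl : a = a' := by simpa using h []
    congr 1
    funext i
    exact ih i fun w => by simpa using h ((i.val + 1) :: w)

variable (g : A.Sym → B.Sym) (hg : ∀ a, B.rk (g a) = A.rk a)

theorem relabel_mk (a : A.Sym) (t : Fin (A.rk a) → Tree A) :
    relabel g hg (WType.mk a t) = WType.mk (g a) fun i => relabel g hg (t (Fin.cast (hg a) i)) := by
  rw [relabel]

theorem pos_relabel (t : Tree A) : (relabel g hg t).pos = t.pos := by
  induction t with
  | mk a t ih =>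
    ext w
    rw [relabel_mk, mem_pos_mk, mem_pos_mk, (finCongr (hg a)).exists_congr_left]
    simp [ih]

theorem label_relabel (t : Tree A) (w : List ℕ) :
    (relabel g hg t).label w = (t.label w).map g := by
  induction t generalizing w with
  | mk a t ih =>
    rcases w with _ | ⟨j, w⟩
    · simp [relabel_mk]
    · by_cases h : 1 ≤ j ∧ j ≤ A.rk a
      · rw [relabel_mk, label, label, dif_pos h, dif_pos (by rwa [hg])]
        exact ih _ _
      · rw [relabel_mk, label, label, dif_neg h, dif_neg (by rwa [hg])]
        rfl

theorem relabel_relabel {C : RankedAlphabet.{w}} (g' : B.Sym → C.Sym)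
    (hg' : ∀ b, C.rk (g' b) = B.rk b) (t : Tree A) :
    relabel g' hg' (relabel g hg t)
      = relabel (fun a => g' (g a)) (fun a => (hg' (g a)).trans (hg a)) t := by
  induction t with
  | mk a t ih =>
    rw [relabel_mk, relabel_mk, relabel_mk]
    congr 1
    funext i
    exact ih _

/-- A position is the root or a child of a labelled position. -/
theorem pos_eq_nil_or_child {t : Tree A} {w : List ℕ} (hw : w ∈ t.pos) :
    w = [] ∨ ∃ w' a, ∃ i : Fin (A.rk a), t.label w' = some a ∧ w = w' ++ [i.val + 1] := by
  induction t generalizing w with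
  | mk a t ih =>
    obtain rfl | ⟨i, w', hw', rfl⟩ := mem_pos_mk.1 hw
    · exact Or.inl rfl
    · right
      obtain rfl | ⟨w'', a', j, h, rfl⟩ := ih i hw'
      · exact ⟨[], a, i, label_nil, rfl⟩
      · exact ⟨(i.val + 1) :: w'', a', j, by rwa [label_cons], rfl⟩

/-- The children of a position with label `a` are exactly those with numbers `1, …, rk a`. -/
theorem exists_label_child {t : Tree A} {w : List ℕ} {a : A.Sym} (h : t.label w = some a) {j : ℕ} :
    (∃ b, t.label (w ++ [j]) = some b) ↔ 1 ≤ j ∧ j ≤ A.rk a := by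
  induction t generalizing w with
  | mk c t ih =>
    rcases w with _ | ⟨k, w⟩
    · obtain rfl : c = a := by simpa using h
      rw [List.nil_append, label]
      split_ifs with hj
      · simp [label_root, hj]
      · simp [hj]
    · rw [label] at h
      split_ifs at h with hk
      rw [← ih _ h, List.cons_append, label, dif_pos hk]

end Tree

/-! ### Evaluation of marked trees -/

section Evaluation

variable {Θ : RankedAlphabet.{u}} {M : Type v} {X : Type w}

/-- The value of a tree, each position `w` of which carries the mark `m w`, under an algebra `f`
over the alphabet of labels paired with marks.  The marks of a subtree are obtained by shifting,
so that no actual relabeling is needed. -/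
def markedHom (f : ∀ a : Θ.Sym, M → (Fin (Θ.rk a) → X) → X) : (List ℕ → M) → Tree Θ → X
  | m, WType.mk a t =>
    f a (m []) fun i => markedHom f (fun w => m ((i.val + 1) :: w)) (t i)

variable {f : ∀ a : Θ.Sym, M → (Fin (Θ.rk a) → X) → X}

theorem markedHom_mk (m : List ℕ → M) (a : Θ.Sym) (t : Fin (Θ.rk a) → Tree Θ) :
    markedHom f m (WType.mk a t)
      = f a (m []) fun i => markedHom f (fun w => m ((i.val + 1) :: w)) (t i) := by
  rw [markedHom]

theorem markedHom_congr {m m' : List ℕ → M} {ξ : Tree Θ} (h : ∀ w ∈ ξ.pos, m w = m' w) :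
    markedHom f m ξ = markedHom f m' ξ := by
  induction ξ generalizing m m' with
  | mk a t ih =>
    rw [Tree.forall_mem_pos_mk] at h
    rw [markedHom_mk, markedHom_mk, h.1]
    congr 1
    funext i
    exact ih i (h.2 i)

theorem markedHom_comap {M' : Type*} (g : M' → M) (m : List ℕ → M') (ξ : Tree Θ) :
    markedHom (fun a c => f a (g c)) m ξ = markedHom f (fun w => g (m w)) ξ := by
  induction ξ generalizing m with
  | mk a t ih => simp only [markedHom_mk, ih]

theorem markedHom_prod {Y : Type*} {g : ∀ a : Θ.Sym, M → (Fin (Θ.rk a) → Y) → Y}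
    (m : List ℕ → M) (ξ : Tree Θ) :
    markedHom (fun a c x => (f a c fun i => (x i).1, g a c fun i => (x i).2)) m ξ
      = (markedHom f m ξ, markedHom g m ξ) := by
  induction ξ generalizing m with
  | mk a t ih => simp only [markedHom_mk, ih]

/-- The marking of `a(t₁, …, t_k)` with the mark `c` at the root and the marking `κ i` of the
`i`-th subtree. -/
def glue {k : ℕ} (c : M) (κ : Fin k → List ℕ → M) : List ℕ → M
  | [] => c
  | j :: w => if h : 1 ≤ j ∧ j ≤ k then κ ⟨j - 1, by omega⟩ w else c

@[simp] theorem glue_nil {k : ℕ} (c : M) (κ : Fin k → List ℕ → M) : glue c κ [] = c := by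
  simp [glue]

@[simp] theorem glue_cons {k : ℕ} (c : M) (κ : Fin k → List ℕ → M) (i : Fin k) (w : List ℕ) :
    glue c κ ((i.val + 1) :: w) = κ i w := by
  rw [glue, dif_pos ⟨by omega, by omega⟩]
  congr

/-- The subset construction: evaluation in the power algebra yields the set of values for all
possible second components of the marking. -/
theorem markedHom_powerset {C : Type*} {f : ∀ a : Θ.Sym, M × C → (Fin (Θ.rk a) → X) → X}
    (m : List ℕ → M) (ξ : Tree Θ) :
    markedHom (X := Set X) (fun a c S => {x | ∃ b y, (∀ i, y i ∈ S i) ∧ x = f a (c, b) y}) m ξ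
      = {x | ∃ κ : List ℕ → C, x = markedHom f (fun w => (m w, κ w)) ξ} := by
  induction ξ generalizing m with
  | mk a t ih =>
    ext x
    simp only [markedHom_mk, ih, Set.mem_ofPred_eq]
    constructor
    · rintro ⟨b, y, hy, rfl⟩
      choose κ hκ using hy
      exact ⟨glue b κ, by simp [← hκ]⟩
    · rintro ⟨κ, rfl⟩
      exact ⟨κ [], _, fun i => ⟨_, rfl⟩, rfl⟩

/-- The symbol of `Θ_U` that consists of a symbol and the marks of its position. -/
def markSym (U : Finset Var) (a : Θ.Sym) (V : Var → Prop) : (withVars Θ U).Sym :=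
  (a, {x : U | V x.1})

/-- The evaluation of `H(ω)` is the evaluation of the tree that is marked by the assignment. -/
theorem hom_encode (U : Finset Var) (ρ : Assignment)
    (ω : ∀ a : (withVars Θ U).Sym, (Fin ((withVars Θ U).rk a) → X) → X) (p : List ℕ)
    (ξ : Tree Θ) :
    Tree.hom ω (encode U ρ p ξ)
      = markedHom (fun a V => ω (markSym U a V)) (fun w => ρ.Marks (p ++ w)) ξ := by
  induction ξ generalizing p with
  | mk a t ih =>
    have h (i : Fin (Θ.rk a)) := ih i (p ++ [i.val + 1])
    simp only [List.append_assoc, List.singleton_append] at h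
    have hω (V : Var → Prop) (hV : ρ.Marks p = V) (x : Fin (Θ.rk a) → X) :
        ω (markSym U a (ρ.Marks p)) x = ω (markSym U a V) x := by subst hV; rfl
    refine .trans ?_ (markedHom_mk _ a t).symm
    simp only [← h]
    rw [encode]
    exact (Tree.hom.eq_1 ω _ _).trans (hω _ (by rw [List.append_nil]) _)

end Evaluation

/-! ### Recognizable properties of marked trees -/

section Recognizability

variable {Θ : RankedAlphabet.{u}} {M : Type v}

/-- A property of marked trees is recognizable if it is decided by a finite algebra, that is, by
a deterministic bottom-up tree automaton.  The set of marks may be infinite. -/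
def Recognizable (L : Tree Θ → (List ℕ → M) → Prop) : Prop :=
  ∃ (Q : Type) (_ : Finite Q) (f : ∀ a : Θ.Sym, M → (Fin (Θ.rk a) → Q) → Q) (Z : Set Q),
    ∀ ξ m, L ξ m ↔ markedHom f m ξ ∈ Z

namespace Recognizable

variable {L L' : Tree Θ → (List ℕ → M) → Prop}

/-- A recognizable property depends only on the marks of the positions of the tree. -/
theorem congr (hL : Recognizable L) {ξ : Tree Θ} {m m' : List ℕ → M}
    (h : ∀ w ∈ ξ.pos, m w = m' w) : L ξ m ↔ L ξ m' := by
  obtain ⟨Q, -, f, Z, hf⟩ := hL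
  rw [hf, hf, markedHom_congr h]

theorem not (hL : Recognizable L) : Recognizable fun ξ m => ¬ L ξ m := by
  obtain ⟨Q, hQ, f, Z, hf⟩ := hL
  exact ⟨Q, hQ, f, Zᶜ, fun ξ m => by simp [hf]⟩

theorem and (hL : Recognizable L) (hL' : Recognizable L') :
    Recognizable fun ξ m => L ξ m ∧ L' ξ m := by
  obtain ⟨Q, hQ, f, Z, hf⟩ := hL
  obtain ⟨Q', hQ', f', Z', hf'⟩ := hL'
  exact ⟨Q × Q', inferInstance, fun a c x => (f a c fun i => (x i).1, f' a c fun i => (x i).2),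
    Z ×ˢ Z', fun ξ m => by
    simp only [markedHom_prod (f := f) (g := f'), Set.mem_prod, hf, hf']⟩

theorem or (hL : Recognizable L) (hL' : Recognizable L') :
    Recognizable fun ξ m => L ξ m ∨ L' ξ m := by
  simpa only [not_and, not_not, ← or_iff_not_imp_left] using (hL.not.and hL'.not).not

theorem comap {M' : Type*} (hL : Recognizable L) (g : M' → M) :
    Recognizable fun ξ (m : List ℕ → M') => L ξ fun w => g (m w) := by
  obtain ⟨Q, hQ, f, Z, hf⟩ := hL
  exact ⟨Q, hQ, fun a c => f a (g c), Z, fun ξ m => by simp only [hf, markedHom_comap]⟩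

/-- Projection: recognizable properties are closed under the choice of a second marking. -/
theorem exists_marking {C : Type*} {L : Tree Θ → (List ℕ → M × C) → Prop} (hL : Recognizable L) :
    Recognizable fun ξ m => ∃ κ : List ℕ → C, L ξ fun w => (m w, κ w) := by
  obtain ⟨Q, hQ, f, Z, hf⟩ := hL
  refine ⟨Set Q, inferInstance,
    fun a c S => {x | ∃ b y, (∀ i, y i ∈ S i) ∧ x = f a (c, b) y}, {S | ∃ q ∈ S, q ∈ Z},
    fun ξ m => ?_⟩
  rw [markedHom_powerset (f := f)]
  simp [hf]

end Recognizable

theorem recognizable_exists_label (R : Θ.Sym → M → Prop) :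
    Recognizable fun (ξ : Tree Θ) m => ∃ w ∈ ξ.pos, ∃ a, ξ.label w = some a ∧ R a (m w) := by
  refine ⟨Prop, inferInstance, fun a c q => R a c ∨ ∃ i, q i, {q | q}, fun ξ m => ?_⟩
  rw [Set.mem_ofPred_eq]
  induction ξ generalizing m with
  | mk a t ih =>
    simp only [Tree.exists_mem_pos_mk, markedHom_mk, ← ih]
    simp

theorem recognizable_exists (R : M → Prop) :
    Recognizable fun (ξ : Tree Θ) m => ∃ w ∈ ξ.pos, R (m w) := by
  obtain ⟨Q, hQ, f, Z, h⟩ := recognizable_exists_label (Θ := Θ) fun _ => R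
  refine ⟨Q, hQ, f, Z, fun ξ m => ?_⟩
  rw [← h]
  simp only [Tree.mem_pos_iff]
  grind

theorem recognizable_forall (R : M → Prop) :
    Recognizable fun (ξ : Tree Θ) m => ∀ w ∈ ξ.pos, R (m w) := by
  simpa using (recognizable_exists (Θ := Θ) fun c => ¬ R c).not

theorem recognizable_root (R : M → Prop) :
    Recognizable fun (_ : Tree Θ) m => R (m []) := by
  refine ⟨Prop, inferInstance, fun _ c _ => R c, {q | q}, fun ξ m => ?_⟩
  cases ξ
  rw [markedHom_mk]
  rfl

theorem recognizable_edge (i : ℕ) (R R' : M → Prop) :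
    Recognizable fun (ξ : Tree Θ) m =>
      ∃ w, w ∈ ξ.pos ∧ w ++ [i + 1] ∈ ξ.pos ∧ R (m w) ∧ R' (m (w ++ [i + 1])) := by
  -- The first component of the state records whether the root satisfies `R'`.
  refine ⟨Prop × Prop, inferInstance, fun a c q =>
    (R' c, (R c ∧ ∃ j : Fin (Θ.rk a), j.val = i ∧ (q j).1) ∨ ∃ j, (q j).2),
    {q | q.2}, fun ξ m => ?_⟩
  rw [Set.mem_ofPred_eq]
  have h₁ (ξ : Tree Θ) (m : List ℕ → M) : (markedHom (fun a c (q : Fin (Θ.rk a) → Prop × Prop) =>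
      (R' c, (R c ∧ ∃ j : Fin (Θ.rk a), j.val = i ∧ (q j).1) ∨ ∃ j, (q j).2)) m ξ).1
      = R' (m []) := by
    cases ξ
    rw [markedHom_mk]
  induction ξ generalizing m with
  | mk a t ih =>
    simp only [Tree.exists_mem_pos_mk, markedHom_mk, h₁, ← ih, List.nil_append,
      List.cons_append, Tree.cons_mem_pos]
    refine or_congr ?_ Iff.rfl
    constructor
    · rintro ⟨h, hR, hR'⟩
      obtain h | ⟨j, w, hw, h⟩ := Tree.mem_pos_mk.1 h
      · cases h
      · simp only [List.cons.injEq, Nat.add_right_cancel_iff] at h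
        obtain ⟨rfl, rfl⟩ := h
        exact ⟨hR, j, rfl, hR'⟩
    · rintro ⟨hR, j, rfl, hR'⟩
      exact ⟨Tree.cons_mem_pos.2 (Tree.nil_mem_pos _), hR, hR'⟩

theorem min_two_add_sum {ι : Type*} (s : Finset ι) (x : ι → ℕ) (n : ℕ) :
    min 2 (n + ∑ i ∈ s, min 2 (x i)) = min 2 (n + ∑ i ∈ s, x i) := by
  classical
  induction s using Finset.induction_on generalizing n with
  | empty => rfl
  | insert i s hi ih =>
    rw [Finset.sum_insert hi, Finset.sum_insert hi, ← add_assoc, ← add_assoc, ih]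
    omega

/-- It is recognizable that exactly one position has a given property: it suffices to count the
positions up to two. -/
theorem recognizable_existsUnique (R : M → Prop) :
    Recognizable fun (ξ : Tree Θ) m => ∃! w, w ∈ ξ.pos ∧ R (m w) := by
  classical
  refine ⟨Fin 3, inferInstance, fun a c q =>
    ⟨min 2 ((if R c then 1 else 0) + ∑ i, (q i).val), by omega⟩, {1}, fun ξ m => ?_⟩
  have h (ξ : Tree Θ) (m : List ℕ → M) :
      (markedHom (fun a c (q : Fin (Θ.rk a) → Fin 3) =>
        (⟨min 2 ((if R c then 1 else 0) + ∑ i, (q i).val), by omega⟩ : Fin 3)) m ξ).val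
        = min 2 (∑ w ∈ ξ.pos, if R (m w) then 1 else 0) := by
    induction ξ generalizing m with
    | mk a t ih =>
      rw [markedHom_mk, Tree.sum_pos_mk]
      simp only [ih, min_two_add_sum]
  rw [Set.mem_singleton_iff, Fin.ext_iff, h, ← Finset.card_filter]
  trans (ξ.pos.filter fun w => R (m w)).card = 1
  · simp only [Finset.card_eq_one, Finset.singleton_iff_unique_mem, Finset.mem_filter]
  · simp only [Fin.val_one]
    omega

end Recognizability

/-! ### Recognizability of MSO-definable properties -/

section MSO

theorem Assignment.marks_setFO (ρ : Assignment) (x : ℕ) (p : List ℕ) :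
    (ρ.setFO x p).Marks
      = fun w => Function.update (ρ.Marks w) (Sum.inl x) (p = w) := by
  funext w v
  rcases v with y | Y
  · by_cases h : y = x
    · subst h; simp [Marks, setFO]
    · simp [Marks, setFO, h]
  · simp [Marks, setFO]

theorem Assignment.marks_setSO (ρ : Assignment) (X : ℕ) (I : Finset (List ℕ)) :
    (ρ.setSO X I).Marks
      = fun w => Function.update (ρ.Marks w) (Sum.inr X) (w ∈ I) := by
  funext w v
  rcases v with y | Y
  · simp [Marks, setSO]
  · by_cases h : Y = X
    · subst h; simp [Marks, setSO]
    · simp [Marks, setSO, h]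

/-- The first-order variables are assigned to positions of the tree. -/
def Assignment.Valid {Θ : RankedAlphabet.{u}} (ρ : Assignment) (ξ : Tree Θ) : Prop :=
  ∀ x, ρ.fo x ∈ ξ.pos

variable {Θ : RankedAlphabet.{u}} {ξ : Tree Θ} {ρ : Assignment}

theorem Assignment.valid_start : Assignment.start.Valid ξ := fun _ => Tree.nil_mem_pos ξ

theorem Assignment.Valid.setFO (h : ρ.Valid ξ) (x : ℕ) {p : List ℕ} (hp : p ∈ ξ.pos) :
    (ρ.setFO x p).Valid ξ := by
  intro y
  by_cases hy : y = x
  · subst hy; simpa [Assignment.setFO]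
  · simpa [Assignment.setFO, hy] using h y

theorem Assignment.Valid.setSO (h : ρ.Valid ξ) (X : ℕ) (I : Finset (List ℕ)) :
    (ρ.setSO X I).Valid ξ := h

/-- The satisfaction of `φ` is a recognizable property of the tree that is marked by the
assignment. -/
def MSO.IsRecognizable (φ : MSO Θ) : Prop :=
  ∃ L : Tree Θ → (List ℕ → Var → Prop) → Prop, Recognizable L ∧
    ∀ ξ (ρ : Assignment), ρ.Valid ξ → (MSO.Sat ξ ρ φ ↔ L ξ ρ.Marks)

namespace MSO.IsRecognizable

variable {φ ψ : MSO Θ}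

theorem not (h : φ.IsRecognizable) : φ.not.IsRecognizable := by
  obtain ⟨L, hL, h⟩ := h
  exact ⟨_, hL.not, fun ξ ρ hρ => by rw [MSO.Sat, h ξ ρ hρ]⟩

theorem ex₁ (x : ℕ) (h : φ.IsRecognizable) : (φ.ex₁ x).IsRecognizable := by
  obtain ⟨L, hL, h⟩ := h
  have hR := ((recognizable_existsUnique (Θ := Θ)
    (Prod.snd : (Var → Prop) × Prop → Prop)).and
    (hL.comap fun c => Function.update c.1 (Sum.inl x) c.2)).exists_marking
  refine ⟨_, hR, fun ξ ρ hρ => ?_⟩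
  rw [MSO.Sat]
  constructor
  · rintro ⟨p, hp, h'⟩
    rw [h _ _ (hρ.setFO x hp), Assignment.marks_setFO] at h'
    exact ⟨fun w => p = w, ⟨p, ⟨hp, rfl⟩, fun y hy => hy.2.symm⟩, h'⟩
  · rintro ⟨κ, ⟨p, ⟨hp, hκ⟩, hu⟩, h'⟩
    refine ⟨p, hp, (h _ _ (hρ.setFO x hp)).2 ?_⟩
    rw [Assignment.marks_setFO]
    refine (hL.congr fun w hw => ?_).1 h'
    congr 1
    exact propext ⟨fun hκ' => (hu w ⟨hw, hκ'⟩).symm, fun e => e ▸ hκ⟩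

theorem ex₂ (X : ℕ) (h : φ.IsRecognizable) : (φ.ex₂ X).IsRecognizable := by
  classical
  obtain ⟨L, hL, h⟩ := h
  have hR := (hL.comap fun c : (Var → Prop) × Prop =>
    Function.update c.1 (Sum.inr X) c.2).exists_marking
  refine ⟨_, hR, fun ξ ρ hρ => ?_⟩
  rw [MSO.Sat]
  constructor
  · rintro ⟨I, -, h'⟩
    rw [h _ _ (hρ.setSO X I), Assignment.marks_setSO] at h'
    exact ⟨fun w => w ∈ I, h'⟩
  · rintro ⟨κ, h'⟩
    refine ⟨ξ.pos.filter κ, Finset.filter_subset _ _, (h _ _ (hρ.setSO X _)).2 ?_⟩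
    rw [Assignment.marks_setSO]
    refine (hL.congr fun w hw => ?_).1 h'
    simp [hw]

end MSO.IsRecognizable

/-- Every MSO-definable property of trees is recognizable. -/
theorem MSO.isRecognizable (φ : MSO Θ) : φ.IsRecognizable := by
  induction φ with
  | label σ x =>
    refine ⟨_, recognizable_exists_label (fun a V => a = σ ∧ V (Sum.inl x)), fun ξ ρ hρ => ?_⟩
    rw [MSO.Sat]
    constructor
    · exact fun h => ⟨ρ.fo x, hρ x, σ, h, rfl, rfl⟩
    · rintro ⟨w, -, _, h, rfl, hw⟩
      rwa [show ρ.fo x = w from hw]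
  | edge i x y =>
    refine ⟨_, recognizable_edge i.val (fun V => V (Sum.inl x)) (fun V => V (Sum.inl y)),
      fun ξ ρ hρ => ?_⟩
    rw [MSO.Sat]
    constructor
    · exact fun h => ⟨ρ.fo x, hρ x, h ▸ hρ y, rfl, h⟩
    · rintro ⟨w, -, -, hx, hy⟩
      rw [show ρ.fo x = w from hx]
      exact hy
  | mem x X =>
    refine ⟨_, recognizable_exists (fun V => V (Sum.inl x) ∧ V (Sum.inr X)), fun ξ ρ hρ => ?_⟩
    rw [MSO.Sat]
    constructor
    · exact fun h => ⟨ρ.fo x, hρ x, rfl, h⟩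
    · rintro ⟨w, -, hx, hX⟩
      rw [show ρ.fo x = w from hx]
      exact hX
  | not φ h => exact h.not
  | or φ ψ h h' =>
    obtain ⟨L, hL, h⟩ := h
    obtain ⟨L', hL', h'⟩ := h'
    exact ⟨_, hL.or hL', fun ξ ρ hρ => by rw [MSO.Sat, h ξ ρ hρ, h' ξ ρ hρ]⟩
  | and φ ψ h h' =>
    obtain ⟨L, hL, h⟩ := h
    obtain ⟨L', hL', h'⟩ := h'
    exact ⟨_, hL.and hL', fun ξ ρ hρ => by rw [MSO.Sat, h ξ ρ hρ, h' ξ ρ hρ]⟩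
  | ex₁ x φ h => exact h.ex₁ x
  | ex₂ X φ h => exact h.ex₂ X
  | all₁ x φ h =>
    obtain ⟨L, hL, h⟩ := (h.not.ex₁ x).not
    exact ⟨L, hL, fun ξ ρ hρ => by rw [← h ξ ρ hρ]; simp [MSO.Sat]⟩
  | all₂ X φ h =>
    obtain ⟨L, hL, h⟩ := (h.not.ex₂ X).not
    exact ⟨L, hL, fun ξ ρ hρ => by rw [← h ξ ρ hρ]; simp [MSO.Sat]⟩

end MSO

/-! ### M-expressions as sums over runs -/

section Runs

/-- The decidability instances are arbitrary, so that they do not matter in unification. -/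
theorem ite_zero_congr {K : Type*} [Zero K] {p q : Prop} {_ : Decidable p} {_ : Decidable q}
    {x y : K} (h : p ↔ q) (h' : x = y) : (if p then x else 0) = if q then y else 0 := by
  subst h'
  by_cases hp : p
  · rw [if_pos hp, if_pos (h.1 hp)]
  · rw [if_neg hp, if_neg (hp ∘ h.2)]

variable {Θ : RankedAlphabet.{u}} {K : Type w} [CompleteMMonoid K]

/-- The extension of a marking of the positions of a tree by a default value. -/
def extend {B : Type*} [Inhabited B] {s : Finset (List ℕ)} (κ : s → B) (w : List ℕ) : B :=
  if h : w ∈ s then κ ⟨w, h⟩ else default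

section extend

variable {B C : Type*} [Inhabited B] [Inhabited C] {s : Finset (List ℕ)}

theorem extend_of_mem (κ : s → B) {w : List ℕ} (hw : w ∈ s) : extend κ w = κ ⟨w, hw⟩ := by
  rw [extend, dif_pos hw]

theorem extend_prod (κ : s → B) (κ' : s → C) (w : List ℕ) :
    extend (fun p => (κ p, κ' p)) w = (extend κ w, extend κ' w) := by
  unfold extend
  split_ifs <;> rfl

end extend

open Classical in
/-- A function on marked trees is run-definable if its value is the sum, over all further
markings of the positions by elements of a finite set `B`, of the value under operations from
`Ω` that are chosen by the label and both marks, restricted by a recognizable property. -/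
def RunDefinable {M : Type v} (s : Tree Θ → (List ℕ → M) → K) : Prop :=
  ∃ (B : Type) (_ : Fintype B) (_ : Inhabited B) (L : Tree Θ → (List ℕ → M × B) → Prop)
    (ω : ∀ a : Θ.Sym, M × B → CompleteMMonoid.Ω (K := K) (Θ.rk a)), Recognizable L ∧
    ∀ ξ m, s ξ m = ∑ κ : ξ.pos → B, if L ξ fun w => (m w, extend κ w) then
      markedHom (fun a c => (ω a c).1) (fun w => (m w, extend κ w)) ξ else 0

namespace RunDefinable

variable {M : Type v} {s s' : Tree Θ → (List ℕ → M) → K}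

theorem markedHom (ω : ∀ a : Θ.Sym, M → CompleteMMonoid.Ω (K := K) (Θ.rk a)) :
    RunDefinable fun ξ m => BET.markedHom (fun a c => (ω a c).1) m ξ := by
  refine ⟨Unit, inferInstance, inferInstance, fun _ _ => True, fun a c => ω a c.1,
    ⟨Unit, inferInstance, fun _ _ _ => (), Set.univ, by simp⟩, fun ξ m => ?_⟩
  simp [markedHom_comap (f := fun a c => (ω a c).1) Prod.fst]

theorem comap {M' : Type*} (h : RunDefinable s) (g : M' → M) :
    RunDefinable fun ξ (m : List ℕ → M') => s ξ fun w => g (m w) := by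
  obtain ⟨B, hB, hB', L, ω, hL, h⟩ := h
  refine ⟨B, hB, hB', _, fun a c => ω a (g c.1, c.2), hL.comap fun c => (g c.1, c.2),
    fun ξ m => ?_⟩
  simp only [h, markedHom_comap (f := fun a c => (ω a c).1) fun c : M' × B => (g c.1, c.2)]

open Classical in
theorem guard (h : RunDefinable s) {L : Tree Θ → (List ℕ → M) → Prop} (hL : Recognizable L) :
    RunDefinable fun ξ m => if L ξ m then s ξ m else 0 := by
  obtain ⟨B, hB, hB', L', ω, hL', h⟩ := h
  refine ⟨B, hB, hB', _, ω, (hL.comap Prod.fst).and hL', fun ξ m => ?_⟩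
  by_cases hm : L ξ m
  · simp [hm, h]
  · simp [hm]

/-- A sum over further markings is absorbed by the markings of the normal form. -/
theorem sum {C : Type} [Fintype C] [Inhabited C] {s : Tree Θ → (List ℕ → M × C) → K}
    (h : RunDefinable s) :
    RunDefinable fun ξ m => ∑ κ : ξ.pos → C, s ξ fun w => (m w, extend κ w) := by
  classical
  obtain ⟨B, hB, hB', L, ω, hL, h⟩ := h
  refine ⟨C × B, inferInstance, inferInstance, _, fun a c => ω a ((c.1, c.2.1), c.2.2),
    hL.comap fun c : M × (C × B) => ((c.1, c.2.1), c.2.2), fun ξ m => ?_⟩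
  rw [← (Equiv.arrowProdEquivProdArrow _ _ _).symm.sum_comp, Fintype.sum_prod_type]
  simp only [h, markedHom_comap (f := fun a c => (ω a c).1) fun c : M × (C × B) =>
    ((c.1, c.2.1), c.2.2)]
  refine Finset.sum_congr rfl fun κ _ => Finset.sum_congr rfl fun κ' _ => ?_
  have hw (w : List ℕ) : ((m w, extend κ w), extend κ' w) =
      ((m w, (extend (fun p => (κ p, κ' p)) w).1), (extend (fun p => (κ p, κ' p)) w).2) := by
    rw [extend_prod]
  exact ite_zero_congr (iff_of_eq (congrArg _ (funext hw)))
    (congrArg (BET.markedHom _ · ξ) (funext hw))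

/-- The markings for the sum of two functions have all their values in the same summand of a
disjoint union; mixed markings are excluded by the recognizable property. -/
theorem add (h : RunDefinable s) (h' : RunDefinable s') :
    RunDefinable fun ξ m => s ξ m + s' ξ m := by
  classical
  obtain ⟨B, hB, hB', L, ω, hL, h⟩ := h
  obtain ⟨B', hB₁, hB₁', L', ω', hL', h'⟩ := h'
  let g : M × (B ⊕ B') → M × B := fun c => (c.1, c.2.elim id default)
  let g' : M × (B ⊕ B') → M × B' := fun c => (c.1, c.2.elim default id)
  let ω₂ (a : Θ.Sym) (c : M × (B ⊕ B')) : CompleteMMonoid.Ω (K := K) (Θ.rk a) :=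
    c.2.elim (fun b => ω a (c.1, b)) fun b => ω' a (c.1, b)
  refine ⟨B ⊕ B', inferInstance, inferInstance, _, ω₂,
    ((hL.comap g).and (recognizable_forall fun c => c.2.isLeft)).or
      ((hL'.comap g').and (recognizable_forall fun c => c.2.isRight)), fun ξ m => ?_⟩
  have hl (κ : ξ.pos → B) : ∀ w ∈ ξ.pos,
      extend (fun p => (Sum.inl (κ p) : B ⊕ B')) w = Sum.inl (extend κ w) :=
    fun w hw => by rw [extend_of_mem _ hw, extend_of_mem _ hw]
  have hr (κ : ξ.pos → B') : ∀ w ∈ ξ.pos,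
      extend (fun p => (Sum.inr (κ p) : B ⊕ B')) w = Sum.inr (extend κ w) :=
    fun w hw => by rw [extend_of_mem _ hw, extend_of_mem _ hw]
  let F (κ : ξ.pos → B) : K := if L ξ fun w => (m w, extend κ w) then
    BET.markedHom (fun a c => (ω a c).1) (fun w => (m w, extend κ w)) ξ else 0
  let F' (κ : ξ.pos → B') : K := if L' ξ fun w => (m w, extend κ w) then
    BET.markedHom (fun a c => (ω' a c).1) (fun w => (m w, extend κ w)) ξ else 0
  simp only [h, h']
  refine (Fintype.sum_sum_type (Sum.elim F F')).symm.trans ?_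
  refine Fintype.sum_of_injective
    (Sum.elim (fun κ p => Sum.inl (κ p)) fun κ p => Sum.inr (κ p)) ?_ _ _ ?_ ?_
  · refine Function.Injective.sumElim (fun κ κ' h => ?_) (fun κ κ' h => ?_) fun κ κ' h => ?_
    · exact funext fun p => Sum.inl_injective (congrFun h p)
    · exact funext fun p => Sum.inr_injective (congrFun h p)
    · cases congrFun h ⟨[], Tree.nil_mem_pos ξ⟩
  · intro κ hκ
    refine if_neg fun hL => hκ ?_
    rcases hL with ⟨-, hκ⟩ | ⟨-, hκ⟩
    · have (p : ξ.pos) : ∃ b, κ p = Sum.inl b := by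
        have := hκ p p.2
        rwa [extend_of_mem _ p.2, Sum.isLeft_iff] at this
      choose κ' hκ' using this
      exact ⟨Sum.inl κ', funext fun p => (hκ' p).symm⟩
    · have (p : ξ.pos) : ∃ b, κ p = Sum.inr b := by
        have := hκ p p.2
        rwa [extend_of_mem _ p.2, Sum.isRight_iff] at this
      choose κ' hκ' using this
      exact ⟨Sum.inr κ', funext fun p => (hκ' p).symm⟩
  · have hnil := Tree.nil_mem_pos ξ
    rintro (κ | κ)
    · have h₁ : (L ξ fun w => g (m w, extend (fun p => Sum.inl (κ p)) w)) ↔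
          L ξ fun w => (m w, extend κ w) := hL.congr fun w hw => by simp [g, hl κ w hw]
      have h₂ : ∀ w ∈ ξ.pos, (extend (fun p => (Sum.inl (κ p) : B ⊕ B')) w).isLeft :=
        fun w hw => by rw [hl κ w hw]; rfl
      have h₃ : ¬ ∀ w ∈ ξ.pos, (extend (fun p => (Sum.inl (κ p) : B ⊕ B')) w).isRight :=
        fun h => by simpa [hl κ _ hnil] using h _ hnil
      refine ite_zero_congr (by simp only [Sum.elim_inl]; tauto) ?_
      refine .trans ?_ (markedHom_congr (m := fun w => (m w, Sum.inl (extend κ w)))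
        fun w hw => by rw [Sum.elim_inl, hl κ w hw])
      exact markedHom_comap (f := fun a c => (ω₂ a c).1)
        (fun c : M × B => (c.1, (Sum.inl c.2 : B ⊕ B'))) _ ξ
    · have h₁ : (L' ξ fun w => g' (m w, extend (fun p => Sum.inr (κ p)) w)) ↔
          L' ξ fun w => (m w, extend κ w) := hL'.congr fun w hw => by simp [g', hr κ w hw]
      have h₂ : ∀ w ∈ ξ.pos, (extend (fun p => (Sum.inr (κ p) : B ⊕ B')) w).isRight :=
        fun w hw => by rw [hr κ w hw]; rfl
      have h₃ : ¬ ∀ w ∈ ξ.pos, (extend (fun p => (Sum.inr (κ p) : B ⊕ B')) w).isLeft :=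
        fun h => by simpa [hr κ _ hnil] using h _ hnil
      refine ite_zero_congr (by simp only [Sum.elim_inr]; tauto) ?_
      refine .trans ?_ (markedHom_congr (m := fun w => (m w, Sum.inr (extend κ w)))
        fun w hw => by rw [Sum.elim_inr, hr κ w hw])
      exact markedHom_comap (f := fun a c => (ω₂ a c).1)
        (fun c : M × B' => (c.1, (Sum.inr c.2 : B ⊕ B'))) _ ξ

end RunDefinable

/-- The value of every M-expression is run-definable, as a function of the tree that is marked by
the assignment. -/
theorem MExp.exists_runDefinable (e : MExp Θ K) :
    ∃ s : Tree Θ → (List ℕ → Var → Prop) → K, RunDefinable s ∧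
      ∀ ξ (ρ : Assignment), ρ.Valid ξ → MExp.eval ξ ρ e = s ξ ρ.Marks := by
  classical
  induction e with
  | H U ω =>
    refine ⟨_, RunDefinable.markedHom fun a V => ω (markSym U a V), fun ξ ρ _ => ?_⟩
    exact hom_encode U ρ (fun a => (ω a).1) [] ξ
  | add e e' h h' =>
    obtain ⟨s, hs, h⟩ := h
    obtain ⟨s', hs', h'⟩ := h'
    exact ⟨_, hs.add hs', fun ξ ρ hρ => by rw [eval, h ξ ρ hρ, h' ξ ρ hρ]⟩
  | guard φ e h =>
    obtain ⟨s, hs, h⟩ := h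
    obtain ⟨L, hL, h'⟩ := φ.isRecognizable
    refine ⟨_, hs.guard hL, fun ξ ρ hρ => ?_⟩
    rw [eval, h ξ ρ hρ]
    exact ite_zero_congr (h' ξ ρ hρ) rfl
  | sum₁ x e h =>
    obtain ⟨s, hs, h⟩ := h
    -- A position is a marking by `Bool` with exactly one value `true`.
    refine ⟨_, ((hs.comap fun c : (Var → Prop) × Bool =>
      Function.update c.1 (Sum.inl x) (c.2 = true)).guard
      (recognizable_existsUnique fun c => c.2 = true)).sum, fun ξ ρ hρ => ?_⟩
    rw [eval]
    have hext (p w : List ℕ) (hp : p ∈ ξ.pos) :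
        (extend (s := ξ.pos) (fun q => decide (p = q.1)) w = true) = (p = w) := by
      unfold extend
      split_ifs with hw
      · simp
      · simpa using fun e : p = w => hw (e ▸ hp)
    refine Finset.sum_of_injOn (fun p q => decide (p = q.1)) ?_ (fun _ _ => Finset.mem_univ _)
      ?_ ?_
    · intro p hp p' hp' hpp
      have := congrFun hpp ⟨p, hp⟩
      exact (show p' = p by simpa using this).symm
    · rintro κ - hκ
      refine if_neg ?_
      rintro ⟨p, ⟨hp, hpκ⟩, hu⟩
      refine hκ ⟨p, hp, funext fun q => ?_⟩
      have := hu q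
      simp only [q.2, extend_of_mem _ q.2, true_and] at this
      by_cases hq : κ q = true
      · simp [this hq, hq]
      · replace hpκ : κ ⟨p, hp⟩ = true := extend_of_mem κ hp ▸ hpκ
        have : p ≠ q := fun e => hq (by rwa [show q = ⟨p, hp⟩ from Subtype.ext e.symm])
        simpa [this] using hq
    · intro p hp
      rw [if_pos]
      · rw [h ξ _ (hρ.setFO x hp), Assignment.marks_setFO]
        simp only [hext p _ hp]
      · simp only [hext p _ hp]
        exact ⟨p, ⟨hp, rfl⟩, fun y hy => hy.2.symm⟩
  | sum₂ X e h =>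
    obtain ⟨s, hs, h⟩ := h
    refine ⟨_, (hs.comap fun c : (Var → Prop) × Bool =>
      Function.update c.1 (Sum.inr X) (c.2 = true)).sum, fun ξ ρ hρ => ?_⟩
    rw [eval]
    refine Finset.sum_nbij' (fun I q => decide (q.1 ∈ I))
      (fun κ => ξ.pos.filter fun w => extend κ w = true) (fun _ _ => Finset.mem_univ _)
      (fun _ _ => Finset.mem_powerset.2 (Finset.filter_subset _ _)) ?_ ?_ ?_
    · intro I hI
      ext w
      rw [Finset.mem_filter]
      constructor
      · rintro ⟨hw, h⟩
        simpa [extend_of_mem _ hw] using h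
      · intro h
        have hw := Finset.mem_powerset.1 hI h
        exact ⟨hw, by simpa [extend_of_mem _ hw] using h⟩
    · intro κ _
      funext q
      simp [extend_of_mem _ q.2]
    · intro I hI
      rw [h ξ _ (hρ.setSO X I), Assignment.marks_setSO]
      have hw (w : List ℕ) :
          (w ∈ I) = (extend (s := ξ.pos) (fun q => decide (q.1 ∈ I)) w = true) := by
        unfold extend
        split_ifs with hw
        · simp
        · simpa using fun h => hw (Finset.mem_powerset.1 hI h)
      exact congrArg (s ξ) (funext fun w =>
        congrArg (Function.update (ρ.Marks w) (Sum.inr X)) (hw w))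

/-- The language of an M-expression is a sum over the markings of the positions by elements of a
finite set, restricted by a finite algebra.  The initial assignment marks the root by all
first-order variables; these marks are replaced by a bit in the additional marking, which is
controlled to be set exactly at the root. -/
theorem MExp.exists_language_eq_sum (e : MExp Θ K) :
    ∃ (B Q : Type) (_ : Fintype B) (_ : Inhabited B) (_ : Finite Q)
      (f : ∀ a : Θ.Sym, B → (Fin (Θ.rk a) → Q) → Q) (Z : Set Q) (_ : DecidablePred (· ∈ Z))
      (ω : ∀ a : Θ.Sym, B → CompleteMMonoid.Ω (K := K) (Θ.rk a)),
      ∀ ξ, e.language ξ = ∑ κ : ξ.pos → B,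
        if BET.markedHom f (extend κ) ξ ∈ Z then
          BET.markedHom (fun a c => (ω a c).1) (extend κ) ξ else 0 := by
  classical
  obtain ⟨s, hs, h⟩ := e.exists_runDefinable
  let V₀ (c : Unit × Bool) : Var → Prop := Sum.elim (fun _ => c.2 = true) fun _ => False
  obtain ⟨B, hB, hB', L, ω, ⟨Q, hQ, f, Z, hf⟩, hs'⟩ := ((hs.comap V₀).guard
    ((recognizable_existsUnique fun c => c.2 = true).and
      (recognizable_root fun c => c.2 = true))).sum
  refine ⟨B, Q, hB, hB', hQ, fun a c => f a ((), c), Z, inferInstance, fun a c => ω a ((), c),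
    fun ξ => ?_⟩
  have hnil := Tree.nil_mem_pos ξ
  trans ∑ κ : ξ.pos → B, if L ξ fun w => ((), extend κ w) then
      BET.markedHom (fun a c => (ω a c).1) (fun w => ((), extend κ w)) ξ else 0
  · rw [← hs' ξ fun _ => (), MExp.language, h ξ _ Assignment.valid_start]
    have hext (w : List ℕ) :
        (extend (s := ξ.pos) (fun q => decide (q.1 = [])) w = true) = (w = []) := by
      unfold extend
      split_ifs with hw
      · simp
      · simpa using fun e : w = [] => hw (e ▸ hnil)
    beta_reduce
    rw [Finset.sum_eq_single fun q : ξ.pos => decide (q.1 = [])]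
    · rw [if_pos]
      · congr 1
        funext w v
        rcases v with x | X
        · simp only [V₀, Sum.elim_inl, hext]
          exact propext eq_comm
        · simp [V₀, Assignment.Marks, Assignment.start]
      · simp only [hext]
        exact ⟨⟨[], ⟨hnil, rfl⟩, fun y hy => hy.2⟩, trivial⟩
    · rintro κ - hκ
      refine if_neg ?_
      rintro ⟨⟨p, -, hu⟩, h₀⟩
      refine hκ (funext fun q => ?_)
      obtain rfl : [] = p := hu [] ⟨hnil, h₀⟩
      have := hu q
      simp only [q.2, extend_of_mem _ q.2, true_and] at this
      by_cases hq : κ q = true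
      · simp [this hq, hq]
      · have : q.1 ≠ [] := fun e => hq (by
          rw [show q = ⟨[], hnil⟩ from Subtype.ext e, ← extend_of_mem κ hnil]
          exact h₀)
        simpa [this] using hq
    · exact fun h => absurd (Finset.mem_univ _) h
  · refine Finset.sum_congr rfl fun κ _ => ite_zero_congr ?_ ?_
    · rw [hf, markedHom_comap (f := f) fun c : B => ((), c)]
    · exact (markedHom_comap (f := fun a c => (ω a c).1) (fun c : B => ((), c)) _ ξ).symm

end Runs

/-! ### Rewriting into behaviours -/

section Rewriting

variable {Δ : RankedAlphabet.{u}} {Sig : RankedAlphabet.{v}}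

/-- The terminal tree that is described by a partially rewritten tree: the first components of
the symbols in `⟨Δ, Sig⟩` are removed, and `*` is disregarded. -/
def forget : Tree (mixed Δ Sig) → Tree Sig
  | WType.mk (Sum.inl σ) t => WType.mk σ fun i : Fin (Sig.rk σ) => forget (t i)
  | WType.mk (Sum.inr ⟨(_, some σ), h⟩) t =>
    WType.mk σ fun i : Fin (Sig.rk σ) => forget (t (Fin.cast h.symm i))
  | WType.mk (Sum.inr ⟨(_, none), h⟩) t => forget (t (Fin.cast h.symm (0 : Fin 1)))

theorem forget_relabel_inl (ξ : Tree Sig) :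
    forget (Tree.relabel (B := mixed Δ Sig) Sum.inl (fun _ => rfl) ξ) = ξ := by
  induction ξ with
  | mk σ t ih =>
    exact (congrArg forget (Tree.relabel_mk _ _ σ t)).trans
      ((forget.eq_1 _ _).trans (congrArg (WType.mk σ) (funext ih)))

theorem Rewrite.forget_eq {t t' : Tree (mixed Δ Sig)} (h : Rewrite Δ Sig t t') :
    forget t = forget t' := by
  induction h with
  | star σ t δ h => 
    exact (forget.eq_3 δ h fun _ =>
      WType.mk (β := fun a => Fin ((mixed Δ Sig).rk a)) (Sum.inl σ) t).symm
  | sym σ t δ h => exact (forget.eq_1 σ t).trans (forget.eq_2 δ σ h fun i => t (Fin.cast h i)).symm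
  | context a t i t' _ ih =>
    have hu (j) : forget (Function.update t i t' j) = forget (t j) := by
      by_cases hj : j = i
      · subst hj; simp [ih]
      · simp [hj]
    obtain σ | ⟨⟨δ, _ | σ⟩, h⟩ := a
    · exact (forget.eq_1 _ _).trans
        (.trans (congrArg (WType.mk σ) (funext fun j => (hu j).symm)) (forget.eq_1 _ _).symm)
    · exact (forget.eq_3 _ _ _).trans ((hu _).symm.trans (forget.eq_3 _ _ _).symm)
    · exact (forget.eq_2 _ _ _ _).trans
        (.trans (congrArg (WType.mk σ) (funext fun j => (hu _).symm)) (forget.eq_2 _ _ _ _).symm)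

/-- All children of a node can be rewritten independently. -/
theorem reflTransGen_rewrite_mk (a : (mixed Δ Sig).Sym)
    {t t' : Fin ((mixed Δ Sig).rk a) → Tree (mixed Δ Sig)}
    (h : ∀ i, Relation.ReflTransGen (Rewrite Δ Sig) (t i) (t' i)) :
    Relation.ReflTransGen (Rewrite Δ Sig) (WType.mk a t) (WType.mk a t') := by
  have one (s : Fin ((mixed Δ Sig).rk a) → Tree (mixed Δ Sig)) (i) (x y : Tree (mixed Δ Sig))
      (hxy : Relation.ReflTransGen (Rewrite Δ Sig) x y) :
      Relation.ReflTransGen (Rewrite Δ Sig) (WType.mk a (Function.update s i x))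
        (WType.mk a (Function.update s i y)) := by
    refine hxy.lift (fun z => WType.mk a (Function.update s i z)) fun z z' hz => ?_
    simpa using Rewrite.context a (Function.update s i z) i z' (by simpa using hz)
  suffices H : ∀ I : Finset (Fin ((mixed Δ Sig).rk a)),
      Relation.ReflTransGen (Rewrite Δ Sig) (WType.mk a t) (WType.mk a (I.piecewise t' t)) by
    simpa using H Finset.univ
  intro I
  induction I using Finset.induction_on with
  | empty => rw [Finset.piecewise_empty]
  | insert i I hi ih =>
    refine ih.trans ?_
    have := one (I.piecewise t' t) i (t i) (t' i) (h i)
    rw [Finset.piecewise_insert]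
    rwa [← Finset.piecewise_eq_of_notMem I t' t hi, Function.update_eq_self] at this

/-- Every tree over `⟨Δ, Sig⟩` is derivable from the terminal tree that it describes. -/
theorem reflTransGen_rewrite_forget (ζ : Tree (extension Δ Sig)) :
    Relation.ReflTransGen (Rewrite Δ Sig)
      (Tree.relabel (B := mixed Δ Sig) Sum.inl (fun _ => rfl)
        (forget (Tree.relabel (B := mixed Δ Sig) Sum.inr (fun _ => rfl) ζ)))
      (Tree.relabel (B := mixed Δ Sig) Sum.inr (fun _ => rfl) ζ) := by
  induction ζ with
  | mk a t ih =>
    obtain ⟨⟨δ, _ | σ⟩, h⟩ := a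
    · have h' : Δ.rk δ = 1 := h
      set ξ := forget (Tree.relabel (B := mixed Δ Sig) Sum.inr (fun _ => rfl)
        (WType.mk (⟨(δ, none), h⟩ : (extension Δ Sig).Sym) t)) with hξ
      have hi (i) : forget (Tree.relabel (B := mixed Δ Sig) Sum.inr (fun _ => rfl) (t i)) = ξ := by
        have hi : Fin.cast h.symm (0 : Fin 1) = i :=
          Fin.ext (by have := i.2; change i.val < Δ.rk δ at this; simp; omega)
        rw [hξ, ← hi]
        exact ((congrArg forget (Tree.relabel_mk _ _ _ t)).trans (forget.eq_3 _ _ _)).symm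
      have ih (i) := hi i ▸ ih i
      rcases ξ with ⟨σ, s⟩
      exact .head (Rewrite.star σ _ δ h) (reflTransGen_rewrite_mk _ ih)
    · rw [(congrArg forget (Tree.relabel_mk (B := mixed Δ Sig) Sum.inr (fun _ => rfl)
        ⟨(δ, some σ), h⟩ t)).trans (forget.eq_2 _ _ _ _)]
      exact .head (Rewrite.sym σ _ δ h) (reflTransGen_rewrite_mk _ fun i => ih i)

/-- Derivability of a tree over `⟨Δ, Sig⟩` from a terminal tree, without rewriting. -/
theorem reflTransGen_rewrite_iff {ξ : Tree Sig} {ζ : Tree (extension Δ Sig)} :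
    Relation.ReflTransGen (Rewrite Δ Sig)
      (Tree.relabel (B := mixed Δ Sig) Sum.inl (fun _ => rfl) ξ)
      (Tree.relabel (B := mixed Δ Sig) Sum.inr (fun _ => rfl) ζ) ↔
    forget (Tree.relabel (B := mixed Δ Sig) Sum.inr (fun _ => rfl) ζ) = ξ := by
  constructor
  · intro h
    have (t t' : Tree (mixed Δ Sig)) (h : Relation.ReflTransGen (Rewrite Δ Sig) t t') :
        forget t = forget t' := by
      induction h with
      | refl => rfl
      | tail _ h ih => exact ih.trans h.forget_eq
    rw [← this _ _ h, forget_relabel_inl]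
  · rintro rfl
    exact reflTransGen_rewrite_forget ζ

end Rewriting

/-! ### Derivation trees as labelings of behaviours -/

namespace Rule

variable {S : StorageType.{u}} {Sig : RankedAlphabet.{v}} {N : Type}

/-- The terminal symbol of a rule; a chain rule has the symbol `*`. -/
def symb : Rule S Sig N → Option Sig.Sym
  | sym _ _ σ _ _ => some σ
  | chain _ _ _ _ => none

theorem starRk_symb (r : Rule S Sig N) : starRk Sig r.symb = r.rank := by
  cases r <;> rfl

/-- The predicate and the instructions of the rule belong to `P'` and `F'`. -/
def Over (P' : Finset S.P) (F' : Finset S.F) (r : Rule S Sig N) : Prop :=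
  r.pred ∈ P' ∧ ∀ i, r.instr i ∈ F'

variable {P' : Finset S.P} {F' : Finset S.F}

/-- The symbol of `⟨Δ, Sig⟩` that a rule contributes to a behaviour on the terminal tree. -/
noncomputable def toSym (r : Rule S Sig N) (h : r.Over P' F') :
    (extension (corr Sig P' F') Sig).Sym :=
  ⟨(⟨⟨r.rank, Nat.lt_succ_of_le r.rank_le⟩, ⟨r.pred, h.1⟩, fun i => ⟨r.instr i, h.2 i⟩⟩, r.symb),
    r.starRk_symb.symm⟩

end Rule

namespace RTG

variable {S : StorageType.{u}} {Sig : RankedAlphabet.{v}} {K : Type w} [CompleteMMonoid K]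
  {P' : Finset S.P} {F' : Finset S.F} (G : RTG S Sig K) (hG : ∀ r ∈ G.R, r.Over P' F')

/-- The tree over `⟨Δ, Sig⟩` that is obtained from a tree of rules by removing nonterminals. -/
noncomputable def toBeh : Tree G.rules → Tree (extension (corr Sig P' F') Sig) :=
  Tree.relabel (fun r : G.rules.Sym => r.1.toSym (hG r.1 r.2)) fun _ => rfl

theorem pos_toBeh (d : Tree G.rules) : (G.toBeh hG d).pos = d.pos :=
  Tree.pos_relabel _ _ d

/-- The nonterminals on the right-hand sides of the rules are the left-hand sides of the rules at
the children. -/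
def Consistent (d : Tree G.rules) : Prop :=
  ∀ w ∈ d.pos, ∀ r : G.rules.Sym, d.label w = some r → ∀ i : Fin r.1.rank,
    ∃ r' : G.rules.Sym, d.label (w ++ [i.val + 1]) = some r' ∧ r.1.rhs i = r'.1.lhs

variable {G}

theorem consistent_mk {r : G.rules.Sym} {d : Fin (G.rules.rk r) → Tree G.rules} :
    G.Consistent (WType.mk r d) ↔
      (∀ i : Fin r.1.rank, r.1.rhs i = (d i).root.1.lhs) ∧ ∀ i, G.Consistent (d i) := by
  rw [Consistent, Tree.forall_mem_pos_mk]
  refine and_congr ?_ (forall_congr' fun i => ?_)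
  · have h (i : Fin (G.rules.rk r)) : Tree.label (WType.mk r d) ([] ++ [i.val + 1])
        = some (d i).root := by
      rw [List.nil_append, Tree.label_cons, Tree.label_root]
    constructor
    · intro H i
      obtain ⟨r', hr', e⟩ := H r Tree.label_nil i
      rw [h i, Option.some_inj] at hr'
      rw [e, hr']
    · intro H r' hr'
      rw [Tree.label_nil, Option.some_inj] at hr'
      subst hr'
      exact fun i => ⟨_, h i, H i⟩
  · simp only [List.cons_append, Tree.label_cons]
    rfl

theorem forget_toBeh (d : Tree G.rules) :
    forget (Tree.relabel (B := mixed (corr Sig P' F') Sig) Sum.inr (fun _ => rfl)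
      (G.toBeh hG d)) = G.proj d := by
  induction d with
  | mk r d ih =>
    obtain ⟨⟨A, p, σ, B, f⟩ | ⟨A, p, B, f⟩, hr⟩ := r
    · exact (forget.eq_2 _ _ _ _).trans
        ((congrArg (WType.mk σ) (funext ih)).trans (proj.eq_1 _ _ _ _ _ _ _ _).symm)
    · exact (forget.eq_3 _ _ _).trans ((ih (0 : Fin 1)).trans (proj.eq_2 _ _ _ _ _ _ _).symm)

theorem mem_behaviours_relabel_iff {A : RankedAlphabet} {n : ℕ} {P' : Finset S.P}
    {F' : Finset S.F}
    (g : A.Sym → (corrAlphabet n P' F').Sym) (hg : ∀ a, (corrAlphabet n P' F').rk (g a) = A.rk a)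
    (c : S.Conf) (d : Tree A) :
    Tree.relabel g hg d ∈ behaviours c ↔ ∃ conf : List ℕ → S.Conf, conf [] = c ∧
      ∀ w ∈ d.pos, ∀ a, d.label w = some a → (g a).2.1.1.1 (conf w) = true ∧
        ∀ i : Fin (g a).1, conf (w ++ [i.val + 1]) ∈ ((g a).2.2 i).1.1 (conf w) := by
  simp only [behaviours, Set.mem_ofPred_eq, Tree.pos_relabel, Tree.label_relabel,
    Option.map_eq_some_iff, forall_exists_index, and_imp, forall_apply_eq_imp_iff₂]

/-- A derivation tree is a consistent tree of rules that describes a behaviour on `ξ`.  The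
alphabet of the behaviour may come from larger sets than those of the occurring predicates and
instructions. -/
theorem mem_derivations_iff {ξ : Tree Sig} {d : Tree G.rules} :
    d ∈ G.derivations G.Z ξ S.init ↔
      (G.Consistent d ∧ d.root.1.lhs ∈ G.Z) ∧ G.toBeh hG d ∈ behavioursOn Sig P' F' ξ := by
  have h : G.betaTree d ∈ behaviours S.init ↔ Tree.relabel (B := corr Sig P' F')
      (fun q : (extension (corr Sig P' F') Sig).Sym => q.1.1) (fun _ => rfl) (G.toBeh hG d) ∈
        behaviours S.init := by
    have e := Tree.relabel_relabel (C := corr Sig P' F')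
      (fun r : G.rules.Sym => r.1.toSym (hG r.1 r.2)) (fun _ => rfl)
      (fun q : (extension (corr Sig P' F') Sig).Sym => q.1.1) (fun _ => rfl) d
    refine .trans ?_ (iff_of_eq (congrArg (· ∈ behaviours S.init) e)).symm
    exact (mem_behaviours_relabel_iff _ _ _ _).trans
      (mem_behaviours_relabel_iff (A := G.rules) (P' := P') (F' := F')
        (fun r : G.rules.Sym => (r.1.toSym (hG r.1 r.2)).1.1) (fun _ => rfl) S.init d).symm
  rw [derivations, behavioursOn, Set.mem_ofPred_eq, Set.mem_ofPred_eq, h, reflTransGen_rewrite_iff,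
    forget_toBeh]
  exact ⟨fun ⟨a, b, c, d⟩ => ⟨⟨c, a⟩, b, d⟩, fun ⟨⟨c, a⟩, b, d⟩ => ⟨a, b, c, d⟩⟩

/-- The weight of a behaviour `ζ` on a terminal tree: the sum over the trees of rules that are
consistent, start with an initial nonterminal and describe `ζ`. -/
noncomputable def behWeight (ζ : Tree (extension (corr Sig P' F') Sig)) : K :=
  csum fun d : {d : Tree G.rules // (G.Consistent d ∧ d.root.1.lhs ∈ G.Z) ∧ G.toBeh hG d = ζ} =>
    G.weight d.1

/-- The language of a grammar is the composition of `𝓑_Δ` with the weight of behaviours. -/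
theorem language_eq_comp : G.language = comp (behavioursOn Sig P' F') (behWeight hG) := by
  funext ξ
  let π (d : G.derivations G.Z ξ S.init) : behavioursOn Sig P' F' ξ :=
    ⟨G.toBeh hG d, ((mem_derivations_iff hG).1 d.2).2⟩
  rw [language, csum_partition π, comp]
  congr 1
  funext ζ
  let e : {d // π d = ζ} ≃
      {d : Tree G.rules // (G.Consistent d ∧ d.root.1.lhs ∈ G.Z) ∧ G.toBeh hG d = ζ} :=
    { toFun := fun d => ⟨d.1.1, ((mem_derivations_iff hG).1 d.1.2).1, congrArg Subtype.val d.2⟩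
      invFun := fun d => ⟨⟨d.1, (mem_derivations_iff hG).2 ⟨d.2.1, by rw [d.2.2]; exact ζ.2⟩⟩,
        Subtype.ext d.2.2⟩ }
  exact csum_equiv e fun d => G.weight d.1

end RTG

/-! ### Grammars from run-definable functions -/

namespace Rule

variable {S : StorageType.{u}} {Sig : RankedAlphabet.{v}} {N : Type}
  {P' : Finset S.P} {F' : Finset S.F}

theorem finite_over [Finite N] : {r : Rule S Sig N | r.Over P' F'}.Finite := by
  let g : (Σ σ : Sig.Sym, N × P' × (Fin (Sig.rk σ) → N) × (Fin (Sig.rk σ) → F')) ⊕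
      (N × P' × N × F') → Rule S Sig N :=
    Sum.elim (fun x => sym x.2.1 x.2.2.1 x.1 x.2.2.2.1 fun i => (x.2.2.2.2 i).1)
      fun x => chain x.1 x.2.1 x.2.2.1 x.2.2.2.1
  refine (Set.finite_range g).subset ?_
  rintro (⟨A, p, σ, B, f⟩ | ⟨A, p, B, f⟩) ⟨hp, hf⟩
  · exact ⟨Sum.inl ⟨σ, A, ⟨p, hp⟩, B, fun i => ⟨f i, hf i⟩⟩, rfl⟩
  · exact ⟨Sum.inr ⟨A, ⟨p, hp⟩, B, ⟨f, hf (0 : Fin 1)⟩⟩, rfl⟩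

/-- Every symbol of `⟨Δ, Sig⟩` can be equipped with nonterminals to form a rule. -/
theorem exists_toSym_eq (a : (extension (corr Sig P' F') Sig).Sym) (A : N)
    (B : Fin ((extension (corr Sig P' F') Sig).rk a) → N) :
    ∃ (r : Rule S Sig N) (h : r.Over P' F') (e : r.toSym h = a), r.lhs = A ∧
      ∀ i : Fin r.rank, r.rhs i = B (Fin.cast (by rw [← e]; rfl) i) := by
  obtain ⟨⟨⟨⟨k, hk⟩, p, f⟩, _ | σ⟩, h⟩ := a
  · change k = 1 at h
    subst h
    refine ⟨chain A p (B (0 : Fin 1)) (f (0 : Fin 1)), ⟨p.2, fun _ => (f (0 : Fin 1)).2⟩, ?_, rfl,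
      fun i => ?_⟩
    · have hf : (fun _ => f (0 : Fin 1)) = f :=
        funext fun i => congrArg f (Subsingleton.elim (α := Fin 1) _ _)
      refine Subtype.ext (Prod.ext ?_ rfl)
      exact congrArg (fun g => (⟨⟨1, hk⟩, p, g⟩ : (corr Sig P' F').Sym)) hf
    · exact congrArg B (Subsingleton.elim (α := Fin 1) _ _)
  · change k = Sig.rk σ at h
    subst h
    exact ⟨sym A p σ B fun i => f i, ⟨p.2, fun i => (f i).2⟩, rfl, rfl, fun i => rfl⟩

/-- Rules with the same symbol of `⟨Δ, Sig⟩` differ in their nonterminals only. -/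
theorem eq_of_toSym_eq {r r' : Rule S Sig N} (h : r.Over P' F') (h' : r'.Over P' F')
    (e : r.toSym h = r'.toSym h') (hl : r.lhs = r'.lhs)
    (hr : ∀ i : Fin r.rank, r.rhs i = r'.rhs (Fin.cast
      (congrArg (extension (corr Sig P' F') Sig).rk e) i)) : r = r' := by
  have e₁ : (⟨⟨r.rank, _⟩, ⟨r.pred, h.1⟩, fun i => ⟨r.instr i, h.2 i⟩⟩ : (corr Sig P' F').Sym) =
      ⟨⟨r'.rank, _⟩, ⟨r'.pred, h'.1⟩, fun i => ⟨r'.instr i, h'.2 i⟩⟩ :=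
    congrArg (fun q => q.1.1) e
  have e₂ : r.symb = r'.symb := congrArg (fun q => q.1.2) e
  obtain ⟨A, p, σ, B, f⟩ | ⟨A, p, B, f⟩ := r <;>
    obtain ⟨A', p', σ', B', f'⟩ | ⟨A', p', B', f'⟩ := r'
  · obtain rfl : σ = σ' := Option.some_inj.1 e₂
    obtain rfl : A = A' := hl
    obtain rfl : B = B' := funext hr
    have := eq_of_heq (Sigma.mk.inj e₁).2
    obtain rfl : p = p' := congrArg (fun x => x.1.1) this
    obtain rfl : f = f' := funext fun i => congrArg (fun x => (x.2 i).1) this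
    rfl
  · cases e₂
  · cases e₂
  · obtain rfl : A = A' := hl
    obtain rfl : B = B' := hr (0 : Fin 1)
    have := eq_of_heq (Sigma.mk.inj e₁).2
    obtain rfl : p = p' := congrArg (fun x => x.1.1) this
    obtain rfl : f = f' := congrArg (fun x => (x.2 (0 : Fin 1)).1) this
    rfl

end Rule

section RunGrammar

variable {S : StorageType.{u}} {Sig : RankedAlphabet.{v}} {K : Type w} [CompleteMMonoid K]
  {P' : Finset S.P} {F' : Finset S.F} {B Q : Type} [Fintype B] [Inhabited B] [Finite Q]

/-- The grammar whose nonterminals are pairs of a state of the algebra `f` and a mark.  Its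
derivation trees correspond to the marked trees over `⟨Δ, Sig⟩` with value in `Z`. -/
noncomputable def runGrammar
    (f : ∀ a : (extension (corr Sig P' F') Sig).Sym, B →
      (Fin ((extension (corr Sig P' F') Sig).rk a) → Q) → Q)
    (ω : ∀ a : (extension (corr Sig P' F') Sig).Sym, B →
      CompleteMMonoid.Ω (K := K) ((extension (corr Sig P' F') Sig).rk a))
    (Z : Set Q) (hP : P'.Nonempty) (hSig : ∃ σ : Sig.Sym, Sig.rk σ = 0) :
    RTG S Sig K where
  N := Q × B
  finite_N := inferInstance
  Z := {A | A.1 ∈ Z}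
  R := {r | ∃ h : r.Over P' F', r.lhs.1 = f (r.toSym h) r.lhs.2 fun i => (r.rhs i).1}
  finite_R := Rule.finite_over.subset fun _ h => h.1
  nonempty_R := by
    obtain ⟨p, hp⟩ := hP
    obtain ⟨σ, hσ⟩ := hSig
    have : IsEmpty (Fin (Sig.rk σ)) := by rw [hσ]; infer_instance
    obtain ⟨a, ha⟩ : ∃ a : (extension (corr Sig P' F') Sig).Sym,
        IsEmpty (Fin ((extension (corr Sig P' F') Sig).rk a)) :=
      ⟨⟨(⟨⟨Sig.rk σ, Nat.lt_succ_of_le ((Sig.rk_le_maxrk σ).trans (le_max_right _ _))⟩, ⟨p, hp⟩,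
        isEmptyElim (α := Fin (Sig.rk σ))⟩, some σ), rfl⟩, this⟩
    obtain ⟨r, h, rfl, hl, -⟩ := Rule.exists_toSym_eq a (f a default isEmptyElim, (default : B))
      isEmptyElim
    refine ⟨r, h, ?_⟩
    rw [hl]
    exact congrArg (f _ _) (Subsingleton.elim _ _)
  wt r := ω (r.1.toSym r.2.1) r.1.lhs.2

variable
  {f : ∀ a : (extension (corr Sig P' F') Sig).Sym, B →
      (Fin ((extension (corr Sig P' F') Sig).rk a) → Q) → Q}
  {ω : ∀ a : (extension (corr Sig P' F') Sig).Sym, B →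
      CompleteMMonoid.Ω (K := K) ((extension (corr Sig P' F') Sig).rk a)}
  {Z : Set Q} {hP : P'.Nonempty} {hSig : ∃ σ : Sig.Sym, Sig.rk σ = 0}

theorem over_of_mem_runGrammar : ∀ r ∈ (runGrammar f ω Z hP hSig).R, r.Over P' F' :=
  fun _ h => h.1

/-- The second components of the nonterminals are given by the marking. -/
def HasMarks (κ : List ℕ → B) (d : Tree (runGrammar f ω Z hP hSig).rules) : Prop :=
  ∀ w r, d.label w = some r → (Rule.lhs r.1).2 = κ w

theorem hasMarks_mk {κ : List ℕ → B} {r : (runGrammar f ω Z hP hSig).rules.Sym}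
    {d : Fin ((runGrammar f ω Z hP hSig).rules.rk r) → Tree (runGrammar f ω Z hP hSig).rules} :
    HasMarks κ (WType.mk r d) ↔
      (Rule.lhs r.1).2 = κ [] ∧ ∀ i, HasMarks (fun w => κ ((i.val + 1) :: w)) (d i) := by
  constructor
  · intro h
    exact ⟨h [] r Tree.label_nil, fun i w r' hr' => h _ r' (by rw [Tree.label_cons]; exact hr')⟩
  · rintro ⟨h₀, h⟩ w r' hw
    have hpos := Tree.mem_pos_iff.2 ⟨r', hw⟩
    obtain rfl | ⟨i, w, -, rfl⟩ := Tree.mem_pos_mk.1 hpos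
    · rw [Tree.label_nil, Option.some_inj] at hw
      rw [← hw, h₀]
    · exact h i w r' (by rwa [Tree.label_cons] at hw)

/-- The states in a consistent tree of rules are the values of the subtrees. -/
theorem lhs_root_eq {κ : List ℕ → B} {d : Tree (runGrammar f ω Z hP hSig).rules}
    (hd : (runGrammar f ω Z hP hSig).Consistent d) (hκ : HasMarks κ d) :
    d.root.1.lhs = (markedHom f κ
      ((runGrammar f ω Z hP hSig).toBeh over_of_mem_runGrammar d), κ []) := by
  induction d generalizing κ with
  | mk r d ih =>
    rw [RTG.consistent_mk] at hd
    rw [hasMarks_mk] at hκ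
    refine Prod.ext ?_ hκ.1
    refine r.2.2.trans (.trans ?_ (markedHom_mk _ _ _).symm)
    refine congrArg₂ (f _) hκ.1 (funext fun i => ?_)
    exact congrArg Prod.fst ((hd.1 i).trans (ih i (hd.2 i) (hκ.2 i)))

theorem weight_eq {κ : List ℕ → B} {d : Tree (runGrammar f ω Z hP hSig).rules}
    (hκ : HasMarks κ d) :
    (runGrammar f ω Z hP hSig).weight d = markedHom (fun a c => (ω a c).1) κ
      ((runGrammar f ω Z hP hSig).toBeh over_of_mem_runGrammar d) := by
  induction d generalizing κ with
  | mk r d ih =>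
    rw [hasMarks_mk] at hκ
    refine .trans ?_ (markedHom_mk _ _ _).symm
    exact (congrArg (fun b => (ω _ b).1 _) hκ.1).trans
      (congrArg (ω _ _).1 (funext fun i => ih i (hκ.2 i)))

/-- A consistent tree of rules is determined by the tree over `⟨Δ, Sig⟩` and the marking, since
the algebra is deterministic. -/
theorem eq_of_hasMarks {κ : List ℕ → B} {d d' : Tree (runGrammar f ω Z hP hSig).rules}
    (hd : (runGrammar f ω Z hP hSig).Consistent d)
    (hd' : (runGrammar f ω Z hP hSig).Consistent d') (hκ : HasMarks κ d) (hκ' : HasMarks κ d')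
    (h : (runGrammar f ω Z hP hSig).toBeh over_of_mem_runGrammar d
      = (runGrammar f ω Z hP hSig).toBeh over_of_mem_runGrammar d') : d = d' := by
  induction d generalizing κ d' with
  | mk r d ih =>
    have hl := (lhs_root_eq hd hκ).trans (h ▸ (lhs_root_eq hd' hκ').symm)
    obtain ⟨r', d'⟩ := d'
    rw [RTG.consistent_mk] at hd hd'
    rw [hasMarks_mk] at hκ hκ'
    obtain ⟨e, h⟩ := Tree.mk_inj h
    have hc (i : Fin (Rule.rank r.1)) :=
      ih i (hd.2 i) (hd'.2 _) (hκ.2 i) (hκ'.2 (Fin.cast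
        (congrArg (extension (corr Sig P' F') Sig).rk e) i)) (h i)
    obtain rfl : r = r' := Subtype.ext (Rule.eq_of_toSym_eq r.2.1 r'.2.1 e hl fun i =>
      (hd.1 i).trans ((congrArg
        (fun t : Tree (runGrammar f ω Z hP hSig).rules => t.root.1.lhs) (hc i)).trans
          (hd'.1 _).symm))
    exact congrArg (WType.mk r) (funext hc)

/-- Every marked tree over `⟨Δ, Sig⟩` comes from a consistent tree of rules. -/
theorem exists_hasMarks (κ : List ℕ → B) (ζ : Tree (extension (corr Sig P' F') Sig)) :
    ∃ d, (runGrammar f ω Z hP hSig).Consistent d ∧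
      (runGrammar f ω Z hP hSig).toBeh over_of_mem_runGrammar d = ζ ∧ HasMarks κ d := by
  induction ζ generalizing κ with
  | mk a t ih =>
    choose d hd hd' hκ using fun i : Fin ((extension (corr Sig P' F') Sig).rk a) =>
      ih i fun w => κ ((i.val + 1) :: w)
    obtain ⟨r, h, rfl, hl, hr⟩ := Rule.exists_toSym_eq a
      (f a (κ []) fun i => ((d i).root.1.lhs).1, κ []) fun i => (d i).root.1.lhs
    have hr (i : Fin r.rank) : r.rhs i = (d i).root.1.lhs := hr i
    have hR : r ∈ (runGrammar f ω Z hP hSig).R := by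
      refine ⟨h, ?_⟩
      rw [hl]
      exact congrArg (f _ _) (funext fun i => (congrArg Prod.fst (hr i)).symm)
    refine ⟨WType.mk (⟨r, hR⟩ : (runGrammar f ω Z hP hSig).rules.Sym) d, ?_, ?_, ?_⟩
    · exact RTG.consistent_mk.2 ⟨hr, hd⟩
    · exact congrArg (WType.mk _) (funext hd')
    · exact hasMarks_mk.2 ⟨congrArg Prod.snd hl, hκ⟩

theorem behWeight_runGrammar [DecidablePred (· ∈ Z)]
    (ζ : Tree (extension (corr Sig P' F') Sig)) :
    RTG.behWeight (G := runGrammar f ω Z hP hSig) over_of_mem_runGrammar ζ =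
      ∑ κ : ζ.pos → B, if markedHom f (extend κ) ζ ∈ Z then
        markedHom (fun a c => (ω a c).1) (extend κ) ζ else 0 := by
  let m (d : Tree (runGrammar f ω Z hP hSig).rules) (p : ζ.pos) : B :=
    ((d.label p).map fun r => (Rule.lhs r.1).2).getD default
  have hm (d : Tree (runGrammar f ω Z hP hSig).rules)
      (hd : (runGrammar f ω Z hP hSig).toBeh over_of_mem_runGrammar d = ζ) :
      HasMarks (extend (m d)) d := by
    intro w r hr
    have hw : w ∈ ζ.pos := by
      rw [← hd, RTG.pos_toBeh]
      exact Tree.mem_pos_iff.2 ⟨r, hr⟩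
    rw [extend_of_mem _ hw]
    simp [m, hr]
  rw [RTG.behWeight]
  refine csum_eq_sum_of_injective (K := K) (fun d : {d : Tree (runGrammar f ω Z hP hSig).rules //
    ((runGrammar f ω Z hP hSig).Consistent d ∧ d.root.1.lhs ∈ (runGrammar f ω Z hP hSig).Z) ∧
      (runGrammar f ω Z hP hSig).toBeh over_of_mem_runGrammar d = ζ} => m d.1) ?_ _ _ ?_ ?_
  · intro ⟨d, ⟨hd, _⟩, hζ⟩ ⟨d', ⟨hd', _⟩, hζ'⟩ h
    have hmd : m d = m d' := h
    exact Subtype.ext (eq_of_hasMarks hd hd' (hm d hζ) (hmd ▸ hm d' hζ') (hζ.trans hζ'.symm))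
  · intro κ hκ
    have hZ : markedHom f (extend κ) ζ ∈ Z := by
      by_contra hZ
      exact hκ (if_neg hZ)
    obtain ⟨d, hd, hζ, hd'⟩ := exists_hasMarks (f := f) (ω := ω) (Z := Z) (hP := hP)
      (hSig := hSig) (extend κ) ζ
    refine ⟨⟨d, ⟨hd, ?_⟩, hζ⟩, funext fun ⟨p, hp⟩ => ?_⟩
    · rw [lhs_root_eq hd hd', hζ]
      exact hZ
    · have hpd : p ∈ d.pos := by rwa [← RTG.pos_toBeh _ over_of_mem_runGrammar, hζ]
      obtain ⟨r, hr⟩ := Tree.mem_pos_iff.1 hpd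
      rw [← extend_of_mem κ hp, ← hd' p r hr]
      simp [m, hr]
  · rintro ⟨d, ⟨hd, hZ⟩, hζ⟩
    rw [lhs_root_eq hd (hm d hζ), hζ] at hZ
    exact (hζ ▸ weight_eq (hm d hζ)).trans (if_pos hZ).symm

end RunGrammar

theorem def_subset_reg (S : StorageType.{u}) (Sig : RankedAlphabet.{v})
    (hSig : ∃ σ : Sig.Sym, Sig.rk σ = 0) (K : Type w) [CompleteMMonoid K] :
    Def S Sig K ⊆ Reg S Sig K := by
  rintro _ ⟨P', F', hP, -, e, -, rfl⟩
  obtain ⟨B, Q, _, _, _, f, Z, _, ω, h⟩ := e.exists_language_eq_sum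
  refine ⟨runGrammar f ω Z hP hSig, ?_⟩
  rw [RTG.language_eq_comp over_of_mem_runGrammar, sumBeh]
  congr 1
  funext ζ
  rw [h, behWeight_runGrammar]

/-! ### Finite disjunctions and conjunctions, and iterated sums over sets -/

namespace MSO

variable {Θ : RankedAlphabet.{u}}

/-- A closed formula that is never satisfied. -/
def bot : MSO Θ := ex₁ 0 (ex₂ 0 (and (mem 0 0) (not (mem 0 0))))

/-- The disjunction of a list of formulas. -/
def disj (l : List (MSO Θ)) : MSO Θ := l.foldr or bot

/-- The conjunction of a list of formulas. -/
def conj (l : List (MSO Θ)) : MSO Θ := not (disj (l.map not))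

theorem sat_disj {ξ : Tree Θ} {ρ : Assignment} {l : List (MSO Θ)} :
    MSO.Sat ξ ρ (disj l) ↔ ∃ φ ∈ l, MSO.Sat ξ ρ φ := by
  induction l with
  | nil => simp [disj, bot, MSO.Sat]
  | cons φ l ih =>
    rw [List.exists_mem_cons_iff, ← ih]
    rfl

theorem sat_conj {ξ : Tree Θ} {ρ : Assignment} {l : List (MSO Θ)} :
    MSO.Sat ξ ρ (conj l) ↔ ∀ φ ∈ l, MSO.Sat ξ ρ φ := by
  simp [conj, MSO.Sat, sat_disj]

theorem mem_free_disj {x : Var} {l : List (MSO Θ)} :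
    x ∈ (disj l).free ↔ ∃ φ ∈ l, x ∈ φ.free := by
  induction l with
  | nil => simp [disj, bot, free]; tauto
  | cons φ l ih =>
    rw [List.exists_mem_cons_iff, ← ih]
    exact Finset.mem_union

theorem mem_free_conj {x : Var} {l : List (MSO Θ)} :
    x ∈ (conj l).free ↔ ∃ φ ∈ l, x ∈ φ.free := by
  simp [conj, free, mem_free_disj]

end MSO

/-- The assignment that is changed to `I` on the first `n` second-order variables. -/
def Assignment.setMany (ρ : Assignment) {n : ℕ} (I : Fin n → Finset (List ℕ)) : Assignment :=
  ⟨ρ.fo, fun X => if h : X < n then I ⟨X, h⟩ else ρ.so X⟩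

namespace MExp

variable {Θ : RankedAlphabet.{u}} {K : Type w} [CompleteMMonoid K]

/-- The sum over all values of the first `n` second-order variables. -/
def sumMany : ℕ → MExp Θ K → MExp Θ K
  | 0, e => e
  | n + 1, e => sum₂ n (sumMany n e)

theorem mem_free_sumMany {n : ℕ} {e : MExp Θ K} {x : Var} :
    x ∈ (sumMany n e).free ↔ x ∈ e.free ∧ ∀ j < n, x ≠ Sum.inr j := by
  induction n with
  | zero => simp [sumMany]
  | succ n ih =>
    rw [sumMany, free, Finset.mem_erase, ih]
    simp only [Nat.lt_succ_iff_lt_or_eq]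
    grind

theorem eval_sumMany (ξ : Tree Θ) (ρ : Assignment) (n : ℕ) (e : MExp Θ K) :
    eval ξ ρ (sumMany n e)
      = ∑ I : Fin n → ξ.pos.powerset, eval ξ (ρ.setMany fun j => (I j).1) e := by
  induction n generalizing ρ with
  | zero =>
    rw [Fintype.sum_unique]
    simp [sumMany, Assignment.setMany]
  | succ n ih =>
    rw [sumMany, eval, ← Finset.sum_coe_sort,
      ← (Fin.snocEquiv fun _ => (ξ.pos.powerset : Type)).sum_comp, Fintype.sum_prod_type]
    refine Finset.sum_congr rfl fun J _ => ?_
    rw [ih]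
    refine Finset.sum_congr rfl fun I _ => ?_
    congr 1
    simp only [Assignment.setMany, Assignment.setSO, Assignment.mk.injEq, true_and]
    funext X
    by_cases h : X < n
    · have h' : X < n + 1 := by omega
      have : (⟨X, h'⟩ : Fin (n + 1)) = Fin.castSucc ⟨X, h⟩ := rfl
      rw [dif_pos h, dif_pos h', this]
      exact congrArg Subtype.val
        (Fin.snoc_castSucc (α := fun _ => (ξ.pos.powerset : Type)) J I ⟨X, h⟩).symm
    · by_cases hX : X = n
      · subst hX
        have : (⟨X, Nat.lt_succ_self X⟩ : Fin (X + 1)) = Fin.last X := rfl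
        simp [Fin.snocEquiv, this]
      · rw [dif_neg h, dif_neg (by omega), Function.update_of_ne hX]

end MExp

/-! ### Expressions from grammars -/

namespace RTG

section ToExpression

variable {S : StorageType.{u}} {Sig : RankedAlphabet.{v}} {K : Type w} [CompleteMMonoid K]
  {P' : Finset S.P} {F' : Finset S.F} {G : RTG S Sig K} (hG : ∀ r ∈ G.R, r.Over P' F')
  {n : ℕ} (ε : Fin n ≃ G.rules.Sym)

open Classical in
/-- The operation that belongs to the label `a` and the set `V` of marks: if `V` consists of a
single rule and `a` is the symbol of that rule, it is the weight of the rule, and `0` otherwise. -/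
noncomputable def ruleOp (a : (extension (corr Sig P' F') Sig).Sym) (V : Fin n → Prop) :
    CompleteMMonoid.Ω (K := K) ((extension (corr Sig P' F') Sig).rk a) :=
  if h : ∃ j, (ε j).1.toSym (hG (ε j).1 (ε j).2) = a ∧ ∀ i, V i ↔ i = j then
    h.choose_spec.1 ▸ G.wt (ε h.choose)
  else ⟨fun _ => 0, CompleteMMonoid.zero_mem _⟩

theorem ruleOp_eq {j : Fin n} {V : Fin n → Prop} (hV : ∀ i, V i ↔ i = j) :
    ruleOp hG ε ((ε j).1.toSym (hG (ε j).1 (ε j).2)) V = G.wt (ε j) := by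
  have h : ∃ j', (ε j').1.toSym (hG (ε j').1 (ε j').2) = (ε j).1.toSym (hG (ε j).1 (ε j).2) ∧
    ∀ i, V i ↔ i = j' := ⟨j, rfl, hV⟩
  rw [ruleOp, dif_pos h]
  have hj : h.choose = j := ((hV _).1 ((h.choose_spec.2 _).2 rfl))
  generalize_proofs h₁
  generalize h.choose = j' at *
  subst hj
  rfl

theorem ruleOp_ne_zero {a : (extension (corr Sig P' F') Sig).Sym} {V : Fin n → Prop} {x}
    (h : (ruleOp hG ε a V).1 x ≠ 0) :
    ∃ j, (ε j).1.toSym (hG (ε j).1 (ε j).2) = a ∧ ∀ i, V i ↔ i = j := by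
  by_contra hn
  rw [ruleOp, dif_neg hn] at h
  exact h rfl

/-- The variables mark exactly the positions of the rules. -/
def MarksRules (m : List ℕ → Fin n → Prop) (d : Tree G.rules) : Prop :=
  ∀ w ∈ d.pos, ∀ j, m w j ↔ d.label w = some (ε j)

theorem marksRules_mk {m : List ℕ → Fin n → Prop} {r : G.rules.Sym}
    {d : Fin (G.rules.rk r) → Tree G.rules} :
    MarksRules ε m (WType.mk r d) ↔ (∀ j, m [] j ↔ j = ε.symm r) ∧
      ∀ i, MarksRules ε (fun w => m ((i.val + 1) :: w)) (d i) := by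
  rw [MarksRules, Tree.forall_mem_pos_mk]
  simp only [Tree.label_nil, Tree.label_cons, Option.some_inj, Equiv.eq_symm_apply,
    eq_comm (a := r)]
  rfl

theorem markedHom_ruleOp {m : List ℕ → Fin n → Prop} {d : Tree G.rules} (h : MarksRules ε m d) :
    markedHom (fun a V => (ruleOp hG ε a V).1) m (G.toBeh hG d) = G.weight d := by
  induction d generalizing m with
  | mk r d ih =>
    rw [marksRules_mk] at h
    refine (markedHom_mk _ _ _).trans ?_
    obtain ⟨j, rfl⟩ := ε.surjective r
    have hj := ruleOp_eq hG ε (V := m []) (by simpa using h.1)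
    exact (congrFun (congrArg Subtype.val hj) _).trans
      (congrArg (G.wt (ε j)).1 (funext fun i => ih i (h.2 i)))

/-- A marking with nonzero value describes a tree of rules that fit the symbols of `ζ`. -/
theorem exists_marksRules {m : List ℕ → Fin n → Prop}
    {ζ : Tree (extension (corr Sig P' F') Sig)}
    (h : markedHom (fun a V => (ruleOp hG ε a V).1) m ζ ≠ 0) :
    ∃ d, G.toBeh hG d = ζ ∧ MarksRules ε m d := by
  induction ζ generalizing m with
  | mk a t ih =>
    rw [markedHom_mk] at h
    obtain ⟨j, rfl, hj⟩ := ruleOp_ne_zero hG ε h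
    -- By absorption, no child has the value `0`.
    choose d hd hm using fun i => ih i (m := fun w => m ((i.val + 1) :: w)) fun h₀ =>
      h (CompleteMMonoid.absorptive _ _ (ruleOp hG ε _ _).2 _ i h₀)
    refine ⟨WType.mk (ε j) d, congrArg (WType.mk _) (funext hd), ?_⟩
    exact (marksRules_mk ε).2 ⟨by simpa using hj, hm⟩

open Classical in
/-- The formula which states that the rules that are marked by the second-order variables are
consistent, and that the rule at the root starts with an initial nonterminal. -/
noncomputable def derivationFormula : MSO (extension (corr Sig P' F') Sig) :=
  let m := (extension (corr Sig P' F') Sig).maxrk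
  .and
    (.all₁ 0 (.or (.ex₁ 1 (.disj ((List.finRange m).map fun i => .edge i 1 0)))
      (.disj (((Finset.univ : Finset (Fin n)).filter fun j => (ε j).1.lhs ∈ G.Z).toList.map
        fun j => .mem 0 j.val))))
    (.conj ((List.finRange m).map fun i =>
      .all₁ 0 (.all₁ 1 (.or (.not (.edge i 0 1))
        (.disj (((Finset.univ : Finset (Fin n × Fin n)).filter fun q =>
            ∃ h : i.val < (ε q.1).1.rank, (ε q.1).1.rhs ⟨i.val, h⟩ = (ε q.2).1.lhs).toList.map
          fun q => .and (.mem 0 q.1.val) (.mem 1 q.2.val)))))))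

theorem free_derivationFormula {x : Var}
    (hx : x ∈ (derivationFormula (P' := P') (F' := F') ε).free) :
    ∃ j : Fin n, x = Sum.inr j.val := by
  simp [derivationFormula, MSO.free, MSO.mem_free_disj, MSO.mem_free_conj] at hx
  grind

theorem sat_derivationFormula {ζ : Tree (extension (corr Sig P' F') Sig)} {ρ : Assignment}
    {d : Tree G.rules} (hd : G.toBeh hG d = ζ)
    (hm : MarksRules ε (fun w j => w ∈ ρ.so j.val) d) :
    MSO.Sat ζ ρ (derivationFormula ε) ↔ G.Consistent d ∧ d.root.1.lhs ∈ G.Z := by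
  have hpos : ζ.pos = d.pos := by rw [← hd, pos_toBeh]
  replace hm : ∀ w ∈ d.pos, ∀ j : Fin n, w ∈ ρ.so j.val ↔ d.label w = some (ε j) := hm
  have hrk (r : G.rules.Sym) (i : Fin r.1.rank) :
      i.val < (extension (corr Sig P' F') Sig).maxrk :=
    i.2.trans_le ((extension (corr Sig P' F') Sig).rk_le_maxrk (r.1.toSym (hG r.1 r.2)))
  rw [derivationFormula, MSO.Sat, and_comm]
  refine and_congr ?_ ?_
  · trans ∀ i : Fin (extension (corr Sig P' F') Sig).maxrk, ∀ p ∈ d.pos, ∀ q ∈ d.pos,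
      ¬ q = p ++ [i.val + 1] ∨ ∃ j j', (∃ h : i.val < (ε j).1.rank,
        (ε j).1.rhs ⟨i.val, h⟩ = (ε j').1.lhs) ∧ p ∈ ρ.so j.val ∧ q ∈ ρ.so j'.val
    · simp [MSO.Sat, MSO.sat_disj, MSO.sat_conj, Assignment.setFO, hpos]
    constructor
    · intro H w hw r hr i
      obtain ⟨r', hr'⟩ := (Tree.exists_label_child hr).2 ⟨Nat.le_add_left 1 i.val, i.2⟩
      obtain h | ⟨j, j', ⟨hi, h⟩, hj, hj'⟩ :=
        H ⟨i.val, hrk r i⟩ w hw _ (Tree.mem_pos_iff.2 ⟨r', hr'⟩)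
      · exact absurd rfl h
      · rw [hm w hw, hr, Option.some_inj] at hj
        rw [hm _ (Tree.mem_pos_iff.2 ⟨r', hr'⟩), hr', Option.some_inj] at hj'
        subst hj hj'
        exact ⟨_, hr', h⟩
    · intro H i p hp q hq
      rw [← imp_iff_not_or]
      rintro rfl
      obtain ⟨r, hr⟩ := Tree.mem_pos_iff.1 hp
      have hi := (Tree.exists_label_child hr).1 (Tree.mem_pos_iff.1 hq)
      obtain ⟨r', hr', h⟩ := H p hp r hr ⟨i.val, hi.2⟩
      obtain ⟨j, rfl⟩ := ε.surjective r
      obtain ⟨j', rfl⟩ := ε.surjective r'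
      exact ⟨j, j', ⟨hi.2, h⟩, (hm p hp j).2 hr, (hm _ hq j').2 hr'⟩
  · trans ∀ p ∈ d.pos, (∃ q ∈ d.pos, ∃ i : Fin (extension (corr Sig P' F') Sig).maxrk,
      p = q ++ [i.val + 1]) ∨ ∃ j, (ε j).1.lhs ∈ G.Z ∧ p ∈ ρ.so j.val
    · simp [MSO.Sat, MSO.sat_disj, Assignment.setFO, hpos]
    constructor
    · intro H
      obtain ⟨q, -, i, h⟩ | ⟨j, hj, h⟩ := H [] (Tree.nil_mem_pos d)
      · simp at h
      · rw [hm [] (Tree.nil_mem_pos d), Tree.label_root, Option.some_inj] at h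
        rwa [h]
    · intro hZ p hp
      obtain rfl | ⟨q, r, i, hr, rfl⟩ := Tree.pos_eq_nil_or_child hp
      · obtain ⟨j, hj⟩ := ε.surjective d.root
        exact Or.inr ⟨j, hj ▸ hZ, (hm [] hp j).2 (by rw [Tree.label_root, hj])⟩
      · exact Or.inl ⟨q, Tree.mem_pos_iff.2 ⟨r, hr⟩, ⟨i.val, hrk r i⟩, rfl⟩

/-- The second-order variables that mark the positions of the `n` rules. -/
def ruleVars (n : ℕ) : Finset Var := Finset.univ.image fun j : Fin n => Sum.inr j.val

/-- The mark that belongs to the `j`-th rule. -/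
def ruleVar {n : ℕ} (j : Fin n) : ruleVars n :=
  ⟨Sum.inr j.val, Finset.mem_image_of_mem _ (Finset.mem_univ j)⟩

/-- The operations `ruleOp`, as a family for the expression `H(ω)`. -/
noncomputable def ruleFamily (a : (withVars (extension (corr Sig P' F') Sig) (ruleVars n)).Sym) :
    CompleteMMonoid.Ω (K := K)
      ((withVars (extension (corr Sig P' F') Sig) (ruleVars n)).rk a) :=
  ruleOp hG ε a.1 fun j => ruleVar j ∈ a.2

/-- The M-expression for the weight of behaviours: a sum over all markings of the positions by
rules, restricted to derivation trees. -/
noncomputable def toMExp : MExp (extension (corr Sig P' F') Sig) K :=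
  .sumMany n (.guard (derivationFormula ε) (.H (ruleVars n) (ruleFamily hG ε)))

theorem isSentence_toMExp : (toMExp hG ε).IsSentence := by
  refine Finset.eq_empty_of_forall_notMem fun x hx => ?_
  rw [toMExp, MExp.mem_free_sumMany] at hx
  obtain ⟨h, hx⟩ := hx
  obtain h | h := Finset.mem_union.1 h
  · obtain ⟨j, rfl⟩ := free_derivationFormula ε h
    exact hx j.val j.2 rfl
  · obtain ⟨j, -, rfl⟩ := Finset.mem_image.1 h
    exact hx j.val j.2 rfl

theorem language_toMExp : (toMExp hG ε).language = behWeight hG := by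
  classical
  funext ζ
  have hH (ρ : Assignment) : MExp.eval ζ ρ (.H (ruleVars n) (ruleFamily hG ε))
      = markedHom (fun a V => (ruleOp hG ε a V).1) (fun w j => w ∈ ρ.so j.val) ζ :=
    (hom_encode _ ρ (fun a => (ruleFamily hG ε a).1) [] ζ).trans
      (markedHom_comap (f := fun a V => (ruleOp hG ε a V).1)
        (fun (V : Var → Prop) (j : Fin n) => V (Sum.inr j.val)) _ ζ)
  rw [MExp.language, toMExp, MExp.eval_sumMany, behWeight]
  have hso (I : Fin n → Finset (List ℕ)) (j : Fin n) :
      (Assignment.start.setMany I).so j.val = I j := by simp [Assignment.setMany]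
  let I (d : Tree G.rules) (j : Fin n) : ζ.pos.powerset :=
    ⟨ζ.pos.filter fun w => d.label w = some (ε j),
      Finset.mem_powerset.2 (Finset.filter_subset _ _)⟩
  have hI {d : Tree G.rules} (hd : G.toBeh hG d = ζ) : MarksRules ε (fun w j =>
      w ∈ (Assignment.start.setMany fun j => (I d j).1).so j.val) d := by
    intro w hw j
    rw [← pos_toBeh _ hG, hd] at hw
    simp [hso, I, hw]
  symm
  refine csum_eq_sum_of_injective (K := K) (fun d :
    {d : Tree G.rules // (G.Consistent d ∧ d.root.1.lhs ∈ G.Z) ∧ G.toBeh hG d = ζ} =>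
      I d.1) ?_ _ _ ?_ ?_
  · intro ⟨d, _, hd⟩ ⟨d', _, hd'⟩ h
    have h : I d = I d' := h
    have hp : d.pos = d'.pos := by rw [← pos_toBeh _ hG, hd, ← pos_toBeh _ hG d', hd']
    refine Subtype.ext (Tree.ext_label fun w => ?_)
    by_cases hw : w ∈ d.pos
    · obtain ⟨r, hr⟩ := Tree.mem_pos_iff.1 hw
      obtain ⟨j, rfl⟩ := ε.surjective r
      have := (hI hd w hw j).2 hr
      rw [h] at this
      rw [hr, (hI hd' w (hp ▸ hw) j).1 this]
    · have hw' : w ∉ d'.pos := hp ▸ hw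
      rw [Tree.mem_pos_iff, ← Option.isSome_iff_exists, Option.not_isSome_iff_eq_none] at hw hw'
      rw [hw, hw']
  · intro J hJ
    rw [MExp.eval, hH] at hJ
    have hsat := (ite_ne_right_iff.1 hJ)
    obtain ⟨d, hd, hm⟩ := exists_marksRules hG ε hsat.2
    refine ⟨⟨d, (sat_derivationFormula hG ε hd hm).1 hsat.1, hd⟩, funext fun j =>
      Subtype.ext (Finset.ext fun w => ?_)⟩
    simp only [I, Finset.mem_filter]
    have hw (hw : w ∈ ζ.pos) : w ∈ (J j).1 ↔ d.label w = some (ε j) := by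
      have := hm w (by rwa [← pos_toBeh _ hG, hd]) j
      simpa only [hso] using this
    exact ⟨fun h => (hw h.1).2 h.2, fun h =>
      have hp := Finset.mem_powerset.1 (J j).2 h
      ⟨hp, (hw hp).1 h⟩⟩
  · intro ⟨d, h, hd⟩
    rw [MExp.eval, hH, if_pos ((sat_derivationFormula hG ε hd (hI hd)).2 h)]
    exact (hd ▸ markedHom_ruleOp hG ε (hI hd)).symm

end ToExpression

end RTG

theorem reg_subset_def (S : StorageType.{u}) (Sig : RankedAlphabet.{v}) (K : Type w)
    [CompleteMMonoid K] : Reg S Sig K ⊆ Def S Sig K := by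
  rintro _ ⟨G, rfl⟩
  obtain ⟨r, hr⟩ := G.nonempty_R
  obtain ⟨f, hf⟩ := S.F_nonempty
  obtain ⟨n, ⟨ε⟩⟩ := @Finite.exists_equiv_fin G.rules.Sym G.rules.finite
  -- The grammar may have no instructions at all, hence the additional one.
  obtain ⟨F', hF', hF⟩ : ∃ F' : Finset S.F, G.instrs ⊆ F' ∧ F'.Nonempty := by
    classical
    exact ⟨insert ⟨f, hf⟩ G.instrs, Finset.subset_insert _ _, Finset.insert_nonempty _ _⟩
  have hG : ∀ r ∈ G.R, r.Over G.preds F' := fun r hr => by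
    classical
    exact ⟨Finset.mem_image_of_mem _ (G.finite_R.mem_toFinset.2 hr), fun i =>
      hF' (Finset.mem_biUnion.2 ⟨r, G.finite_R.mem_toFinset.2 hr,
        Finset.mem_image_of_mem _ (Finset.mem_univ i)⟩)⟩
  refine ⟨G.preds, F', ⟨_, (hG r hr).1⟩, hF, RTG.toMExp hG ε.symm,
    RTG.isSentence_toMExp hG ε.symm, ?_⟩
  rw [sumBeh, RTG.language_toMExp, ← RTG.language_eq_comp]

end BET

theorem mainTheorem2 (S : BET.StorageType.{u}) (Sig : BET.RankedAlphabet.{v})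
    (hSig : ∃ σ : Sig.Sym, Sig.rk σ = 0) (K : Type w) [BET.CompleteMMonoid K] :
    BET.Reg S Sig K = BET.Def S Sig K := by
  exact (BET.reg_subset_def S Sig K).antisymm (BET.def_subset_reg S Sig hSig K)
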